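/- **Definitions.** Let $G$ be a finite undirected (multi)graph with positive real edge capacities $c(e)$, and let $T$ be a set of its vertices, called terminals. A demand $\mathcal D$ on $T$ assigns a real number $\mathcal D(t,t')\ge 0$ to each unordered pair of distinct terminals. A multicommodity flow, which puts nonnegative amounts of flow on paths between terminals, routes $\mathcal D$ if for all distinct $t,t'\in T$ it sends $\mathcal D(t,t')$ units between $t$ and $t'$. Its congestion is the maximum over the edges $e$ of the total amount of flow sent via $e$ divided by $c(e)$, and $\mathrm{cong}_G(\mathcal D)\in[0,\infty]$ is the minimum congestion of a flow in $G$ that routes $\mathcal D$ ($\infty$ if there is none). A graph $H$ containing $T$ is a flow sparsifier of $G$ with respect to $T$ of quality $q\ge 1$ if $\mathrm{cong}_H(\mathcal D)\le \mathrm{cong}_G(\mathcal D)\le q\cdot \mathrm{cong}_H(\mathcal D)$ for every demand $\mathcal D$ on $T$. It is contraction-based if it is obtained from $G$ by contracting each class of a partition of $V(G)$, in which distinct terminals lie in different classes, into a single node, keeping parallel edges and capacities and discarding self-loops; each terminal is identified with the node of its class. **Theorem 1.1.** There is a polynomial $p$ such that for every real $\varepsilon>0$, every finite edge-capacitated graph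 $G$ and every set $T$ of $5$ vertices of $G$, there is a contraction-based flow sparsifier of $G$ with respect to $T$ of quality $1+\varepsilon$ with at most $2^{p(1/\varepsilon)}$ vertices. In particular, the bound does not depend on $G$ or its capacities. -/

import Mathlib

open scoped NNReal ENNReal

noncomputable section

/-- An undirected edge-capacitated multigraph with vertex type `V` and edge type `E`:
every edge has an unordered pair of endpoints and a positive real capacity. Parallel edges are
allowed. Self-loops are allowed too; they lie on no path and so never carry any flow. -/
structure CapGraph (V E : Type*) where
  ends : E → Sym2 V
  cap : E → ℝ≥0
  cap_pos : ∀ e, 0 < cap e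

namespace CapGraph

/-- Walks from one vertex to another, recording the edges that are traversed. -/
inductive Walk {V E : Type*} (G : CapGraph V E) : V → V → Type _
  | nil (u : V) : Walk G u u
  | cons {u v w : V} (e : E) (h : G.ends e = s(u, v)) (p : Walk G v w) : Walk G u w

/-- The list of edges traversed by a walk. -/
def Walk.edges {V E : Type*} {G : CapGraph V E} : {u v : V} → G.Walk u v → List E
  | _, _, .nil _ => []
  | _, _, .cons e _ p => e :: p.edges

/-- The list of vertices visited by a walk, including both ends. -/
def Walk.support {V E : Type*} {G : CapGraph V E} : {u v : V} → G.Walk u v → List V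
  | _, _, .nil u => [u]
  | u, _, .cons _ _ p => u :: p.support

/-- Paths from `u` to `v`: walks that visit no vertex twice. -/
abbrev Path {V E : Type*} (G : CapGraph V E) (u v : V) : Type _ :=
  {p : G.Walk u v // p.support.Nodup}

/-- A multicommodity flow in `G` between terminals `K`, placed at the vertices `τ : K → V`:
for all terminals `t`, `t'`, a nonnegative amount of flow on each path from `t` to `t'`
(nonzero on finitely many paths). -/
abbrev Flow {V E K : Type*} (G : CapGraph V E) (τ : K → V) : Type _ :=
  ∀ t t' : K, G.Path (τ t) (τ t') →₀ ℝ≥0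

/-- The amount of flow sent from `t` to `t'` or from `t'` to `t`. -/
def Flow.between {V E K : Type*} {G : CapGraph V E} {τ : K → V}
    (f : G.Flow τ) (t t' : K) : ℝ≥0 :=
  ((f t t').sum fun _ x => x) + ((f t' t).sum fun _ x => x)

open Classical in
/-- The total amount of flow sent via the edge `e`, over all paths and in either direction. -/
def Flow.load {V E K : Type*} [Fintype K] {G : CapGraph V E} {τ : K → V}
    (f : G.Flow τ) (e : E) : ℝ≥0 :=
  ∑ t : K, ∑ t' : K, (f t t').sum fun p x => if e ∈ p.1.edges then x else 0

/-- The congestion of a flow: the maximum over the edges of load divided by capacity. -/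
def Flow.congestion {V E K : Type*} [Fintype K] {G : CapGraph V E} {τ : K → V}
    (f : G.Flow τ) : ℝ≥0∞ :=
  ⨆ e : E, (f.load e : ℝ≥0∞) / (G.cap e : ℝ≥0∞)

/-- A demand assigns a nonnegative real number to each unordered pair of distinct terminals
(values on pairs `s(t, t)` are ignored). The flow `f` routes `D` if it sends exactly `D s(t, t')`
units between `t` and `t'`, for all distinct `t`, `t'`. -/
def Flow.Routes {V E K : Type*} {G : CapGraph V E} {τ : K → V}
    (f : G.Flow τ) (D : Sym2 K → ℝ≥0) : Prop :=
  ∀ t t' : K, t ≠ t' → f.between t t' = D s(t, t')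

/-- The congestion of a demand: the least congestion of a flow that routes it, which is `∞`
if no flow does. -/
def congestion {V E K : Type*} [Fintype K] (G : CapGraph V E) (τ : K → V)
    (D : Sym2 K → ℝ≥0) : ℝ≥0∞ :=
  ⨅ (f : G.Flow τ) (_ : f.Routes D), f.congestion

/-- `H`, whose terminals sit at `σ`, is a flow sparsifier of quality `q` of `G`, whose terminals
sit at `τ`. -/
def IsFlowSparsifier {V E V' E' K : Type*} [Fintype K] (G : CapGraph V E) (τ : K → V)
    (H : CapGraph V' E') (σ : K → V') (q : ℝ) : Prop :=
  1 ≤ q ∧ ∀ D : Sym2 K → ℝ≥0,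
    H.congestion σ D ≤ G.congestion τ D ∧
      G.congestion τ D ≤ ENNReal.ofReal q * H.congestion σ D

/-- The graph obtained from `G` by contracting every class of the partition `F` of the vertices
into a single node, keeping parallel edges and capacities and discarding self-loops. -/
def contract {V E : Type*} (G : CapGraph V E) (F : Setoid V) :
    CapGraph (Quotient F) {e : E // ¬ ((G.ends e).map (Quotient.mk F)).IsDiag} where
  ends e := (G.ends e.1).map (Quotient.mk F)
  cap e := G.cap e.1
  cap_pos e := G.cap_pos e.1

/-- The partition `F` defines a contraction-based flow sparsifier of `G` with respect to the
terminal set `T`, of quality `q`: distinct terminals lie in different classes, and the contracted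
graph, in which each terminal is identified with the node of its class, is a flow sparsifier of
quality `q`. -/
def IsContractionSparsifier {V E : Type*} (G : CapGraph V E) (T : Finset V) (F : Setoid V)
    (q : ℝ) : Prop :=
  (∀ t ∈ T, ∀ t' ∈ T, F t t' → t = t') ∧
    G.IsFlowSparsifier (fun t : T => (t : V))
      (G.contract F) (fun t : T => Quotient.mk F (t : V)) q

end CapGraph

end

/-!
The bound on the size of the sparsifier holds with a constant polynomial, and the sparsifier is even
exact: its quality is `1`, hence also `1 + ε`.

The reason is a theorem of Karzanov on multiflows with five terminals. By linear programming
duality (`CapGraph.exists_flow`, `CapGraph.Flow.sum_demand_le`), a demand can be routed with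
congestion `κ` if and only if every pseudometric `δ` on the vertices satisfies the inequality
`∑ D(t, t') δ(t, t') ≤ κ ∑ c(e) δ(e)`. If there are five terminals, then it is enough to have
this inequality for the pseudometrics that are induced by maps from the vertices to the vertices of
the graph `K_{2,3}` (`IsPseudometric.sum_demand_le`); cuts are among these, as maps to the two
ends of an edge. For each of the `5 ^ 5` maps `σ` from the terminals to the vertices of `K_{2,3}`,
choose an extension `φ_σ` of `σ` to all vertices for which `∑ c(e) δ(e)` is least, and contract the
classes of vertices that have the same image under every `φ_σ`. The contracted graph has at most
`5 ^ (5 ^ 5)` vertices, and all these minima, hence all inequalities that matter, are the same as in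
`G` (`CapGraph.congestion_le_of_cost`). Contraction never increases the congestion
(`CapGraph.congestion_contract_le`).

The reduction to `K_{2,3}` works in the tight span of the terminal distances. If the inequality
fails for some pseudometric, take a worst one of total terminal distance `1`; by Dress's
retraction it may be assumed that all vertices lie in the tight span of the five terminals
(`IsPotential.exists_retract`). A map of the tight span to `K_{2,3}` that maps geodesics between
terminals to geodesics can be peeled off: a small multiple of the pseudometric induced by it is
subtracted, which shortens every edge by at least its share (`IsPotential.eventually_sub`). As the
inequality holds for the part peeled off, the rest violates it even more after rescaling, a
contradiction (`IsPotential.value_nonneg`).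

It remains to find such a map for every nonzero pseudometric on five points (`exists_peel`). There
are two constructions: a cut along the geodesics between two points `b₁`, `b₂` if the split
`{b₁, b₂}` against the rest has positive isolation index (`hasPeel_of_split`), and a map onto
`K_{2,3}` near a point `b` that lies between any two of three other points, but not between one of
these and the fifth (`hasPeel_of_center`). For an arbitrary point `b`, consider the graph on the
other four points in which two points are adjacent if `b` lies on a geodesic between them. For each
such graph one of the two constructions applies, at `b` or at one of the other points.
-/

noncomputable section

/-! ### The graph `K_{2,3}`, pseudometrics and tight functions -/

/-- Path distance in the graph `K_{2,3}` on the vertex set `Fin 5`, where `0, 1` are the two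
vertices of degree three and `2, 3, 4` are the three vertices of degree two. -/
def bipartiteDist (i j : Fin 5) : ℕ :=
  if i = j then 0 else if (i < 2 ↔ j < 2) then 2 else 1

/-- `bipartiteDist` as a real number. -/
def kdist (i j : Fin 5) : ℝ := bipartiteDist i j

lemma kdist_self (i : Fin 5) : kdist i i = 0 := by simp [kdist, bipartiteDist]

lemma kdist_comm (i j : Fin 5) : kdist i j = kdist j i := by
  have : ∀ i j : Fin 5, bipartiteDist i j = bipartiteDist j i := by decide
  simp only [kdist, this i j]

lemma kdist_triangle (i j k : Fin 5) : kdist i k ≤ kdist i j + kdist j k := by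
  have : ∀ i j k : Fin 5, bipartiteDist i k ≤ bipartiteDist i j + bipartiteDist j k := by decide
  unfold kdist
  exact_mod_cast this i j k

lemma kdist_nonneg (i j : Fin 5) : 0 ≤ kdist i j := Nat.cast_nonneg _

lemma kdist_pos {i j : Fin 5} (h : i ≠ j) : 0 < kdist i j := by
  have : ∀ i j : Fin 5, i ≠ j → 0 < bipartiteDist i j := by decide
  unfold kdist
  exact_mod_cast this i j h

/-- A real-valued pseudometric, as an unbundled function. -/
structure IsPseudometric {V : Type*} (d : V → V → ℝ) : Prop where
  refl : ∀ x, d x x = 0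
  symm : ∀ x y, d x y = d y x
  triangle : ∀ x y z, d x z ≤ d x y + d y z

lemma IsPseudometric.nonneg {V : Type*} {d : V → V → ℝ} (h : IsPseudometric d) (x y : V) :
    0 ≤ d x y := by
  have := h.triangle x y x
  rw [h.refl, h.symm y x] at this
  linarith

/-- The points of the tight span of a pseudometric `d`, encoded by their distances to the points
of `d`: functions that satisfy the triangle inequalities with `d`, and that lie, for every point
`t`, on a geodesic from `t` to some point `t'`. -/
structure IsTightFn {K : Type*} (d : K → K → ℝ) (f : K → ℝ) : Prop where
  le_add : ∀ t t', d t t' ≤ f t + f t'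
  exists_eq : ∀ t, ∃ t', f t + f t' = d t t'

section TightFn

variable {K : Type*} {d : K → K → ℝ} {f g : K → ℝ}

lemma IsTightFn.nonneg (hd : IsPseudometric d) (hf : IsTightFn d f) (t : K) : 0 ≤ f t := by
  have := hf.le_add t t
  rw [hd.refl] at this
  linarith

lemma IsTightFn.le_add_dist (hd : IsPseudometric d) (hf : IsTightFn d f) (t r : K) :
    f t ≤ f r + d t r := by
  obtain ⟨t', h⟩ := hf.exists_eq t
  have := hf.le_add r t'
  have := hd.triangle t r t'
  linarith

lemma IsTightFn.congr (hd : IsPseudometric d) (hf : IsTightFn d f) {t r : K} (h : d t r = 0) :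
    f t = f r := by
  have h1 := hf.le_add_dist hd t r
  have h2 := hf.le_add_dist hd r t
  have := hd.symm t r
  linarith

lemma isTightFn_dist (hd : IsPseudometric d) (t : K) : IsTightFn d (d t) where
  le_add r r' := by
    have := hd.triangle r t r'
    rw [hd.symm r t] at this
    exact this
  exists_eq r := ⟨t, by rw [hd.refl, hd.symm, add_zero]⟩

/-- A point of the tight span at distance `0` from `b` is the point `b`. -/
lemma IsTightFn.eq_of_zero (hd : IsPseudometric d) (hf : IsTightFn d f) {b : K} (h : f b = 0)
    (t : K) : f t = d b t := by
  have h1 := hf.le_add_dist hd t b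
  have h2 := hf.le_add b t
  have := hd.symm t b
  linarith

lemma IsPseudometric.congr (hd : IsPseudometric d) {t r : K} (h : d t r = 0) : d t = d r := by
  funext x
  rw [hd.symm t x, hd.symm r x]
  exact (isTightFn_dist hd x).congr hd h

/-- The points `t`, `f`, `g`, `t'` lie in this order on a geodesic of the tight span. -/
def OnGeodesic (d : K → K → ℝ) (t : K) (f g : K → ℝ) (t' : K) : Prop :=
  ∃ s : ℝ, (∀ r, |f r - g r| ≤ s) ∧ f t + s + g t' = d t t'

/-- A map from the tight span of `d` to the vertices of `K_{2,3}` is geodesic if it maps the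
geodesics between points of `d` to geodesics of `K_{2,3}`. -/
def IsGeodesicMap (d : K → K → ℝ) (φ : (K → ℝ) → Fin 5) : Prop :=
  ∀ t t' f g, IsTightFn d f → IsTightFn d g → OnGeodesic d t f g t' →
    kdist (φ (d t)) (φ f) + kdist (φ f) (φ g) + kdist (φ g) (φ (d t')) ≤
      kdist (φ (d t)) (φ (d t'))

/-- There is a geodesic map to `K_{2,3}` that is not constant on the points of `d`. A small multiple
of the pseudometric that it induces can then be subtracted from `d`. -/
def HasPeel (d : K → K → ℝ) : Prop :=
  ∃ φ, IsGeodesicMap d φ ∧ ∃ t t', φ (d t) ≠ φ (d t')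

lemma OnGeodesic.symm (hd : IsPseudometric d) {t t' : K} (h : OnGeodesic d t f g t') :
    OnGeodesic d t' g f t := by
  obtain ⟨s, h1, h2⟩ := h
  refine ⟨s, fun r => by rw [abs_sub_comm]; exact h1 r, ?_⟩
  rw [hd.symm t' t, ← h2]
  ring

lemma OnGeodesic.left (hf : IsTightFn d f) {t t' : K} (h : OnGeodesic d t f g t') :
    f t + f t' = d t t' := by
  obtain ⟨s, h1, h2⟩ := h
  have := hf.le_add t t'
  have := (abs_le.1 (h1 t')).2
  linarith

lemma OnGeodesic.right (hg : IsTightFn d g) {t t' : K} (h : OnGeodesic d t f g t') :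
    g t + g t' = d t t' := by
  obtain ⟨s, h1, h2⟩ := h
  have := hg.le_add t t'
  have := (abs_le.1 (h1 t)).1
  linarith

/-- If `f` precedes `g` on a geodesic to `b` and lies on a geodesic from `x` to `b`, then so
does `g`. -/
lemma OnGeodesic.eq_of_eq (hf : IsTightFn d f) (hg : IsTightFn d g) {t b x : K}
    (h : OnGeodesic d t f g b) (hfx : f b + f x = d b x) : g b + g x = d b x := by
  have h3 := h.left hf
  obtain ⟨s, h1, h2⟩ := h
  have := hg.le_add b x
  have := (abs_le.1 (h1 x)).1
  linarith

/-- It suffices to check geodesics between representatives of the classes of points at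
distance `0`. -/
lemma isGeodesicMap_of_cover (hd : IsPseudometric d) (φ : (K → ℝ) → Fin 5) (R : Set K)
    (hR : ∀ t, ∃ r ∈ R, d t r = 0)
    (h : ∀ t ∈ R, ∀ t' ∈ R, ∀ f g, IsTightFn d f → IsTightFn d g → OnGeodesic d t f g t' →
      kdist (φ (d t)) (φ f) + kdist (φ f) (φ g) + kdist (φ g) (φ (d t')) ≤
        kdist (φ (d t)) (φ (d t'))) : IsGeodesicMap d φ := by
  intro t t' f g hf hg hfg
  obtain ⟨r, hr, h1⟩ := hR t
  obtain ⟨r', hr', h2⟩ := hR t'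
  rw [hd.congr h1, hd.congr h2]
  refine h r hr r' hr' f g hf hg ?_
  obtain ⟨s, h3, h4⟩ := hfg
  refine ⟨s, h3, ?_⟩
  rw [← hf.congr hd h1, ← hg.congr hd h2, h4, hd.congr h1, hd.symm r, hd.congr h2, hd.symm]

/-! ### Two kinds of geodesic maps -/

open Classical in
/-- A split with a side `{b₁, b₂}` of at most two points and of positive isolation index gives a
cut: one of its sides consists of the points on geodesics from `b₁` to `b₂`. -/
lemma hasPeel_of_split (hd : IsPseudometric d) (b₁ b₂ : K) (A : Set K) (hA : A.Nonempty)
    (hcov : ∀ t, d t b₁ = 0 ∨ d t b₂ = 0 ∨ ∃ a ∈ A, d t a = 0)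
    (h : ∀ a ∈ A, ∀ a' ∈ A, d a a' + d b₁ b₂ < d a b₁ + d a' b₂ ∨
      d a a' + d b₁ b₂ < d a b₂ + d a' b₁) : HasPeel d := by
  set W : (K → ℝ) → Prop := fun f => f b₁ + f b₂ = d b₁ b₂ with hW
  set φ : (K → ℝ) → Fin 5 := fun f => if W f then 0 else 2 with hφ
  have hb₁ : W (d b₁) := by simp [hW, hd.refl]
  have hb₂ : W (d b₂) := by simp [hW, hd.refl, hd.symm b₂ b₁]
  -- No point lies both on a geodesic inside `A` and on one from `b₁` to `b₂`.
  have hout : ∀ a ∈ A, ∀ a' ∈ A, ∀ f, IsTightFn d f → f a + f a' = d a a' → ¬ W f := by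
    intro a ha a' ha' f hf hfa hWf
    have h1 := hf.le_add a b₁
    have h2 := hf.le_add a' b₂
    have h3 := hf.le_add a b₂
    have h4 := hf.le_add a' b₁
    simp only [hW] at hWf
    rcases h a ha a' ha' with h | h <;> linarith
  have hAout : ∀ a ∈ A, ¬ W (d a) := fun a ha =>
    hout a ha a ha _ (isTightFn_dist hd a) (by simp [hd.refl])
  have hin : ∀ b ∈ ({b₁, b₂} : Set K), ∀ b' ∈ ({b₁, b₂} : Set K), ∀ f, IsTightFn d f →
      f b + f b' = d b b' → W f := by
    rintro b (rfl | rfl) b' (rfl | rfl) f hf h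
    · have h0 : f b' = 0 := by rw [hd.refl] at h; linarith
      simp only [hW, hf.eq_of_zero hd h0, hd.refl, zero_add]
    · exact h
    · simp only [hW]; rw [add_comm, h, hd.symm]
    · have h0 : f b' = 0 := by rw [hd.refl] at h; linarith
      simp only [hW, hf.eq_of_zero hd h0, hd.refl, add_zero, hd.symm b' b₁]
  have hmono : ∀ a, ∀ b ∈ ({b₁, b₂} : Set K), ∀ f g, IsTightFn d f → IsTightFn d g →
      OnGeodesic d a f g b → W f → W g := by
    rintro a b (rfl | rfl) f g hf hg hfg hWf
    · exact hfg.eq_of_eq hf hg hWf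
    · have := hfg.eq_of_eq (x := b₁) hf hg (by rw [add_comm, hd.symm]; exact hWf)
      simp only [hW]; rw [add_comm, this, hd.symm]
  refine ⟨φ, isGeodesicMap_of_cover hd φ ({b₁, b₂} ∪ A) ?_ ?_, ?_⟩
  · intro t
    rcases hcov t with h | h | ⟨a, ha, h⟩
    · exact ⟨b₁, by simp, h⟩
    · exact ⟨b₂, by simp, h⟩
    · exact ⟨a, Or.inr ha, h⟩
  · have hbW : ∀ b ∈ ({b₁, b₂} : Set K), W (d b) := by
      rintro b (rfl | rfl) <;> assumption
    have hφ0 : ∀ f, W f → φ f = 0 := fun f hf => if_pos hf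
    have hφ2 : ∀ f, ¬ W f → φ f = 2 := fun f hf => if_neg hf
    rintro t (ht | ht) t' (ht' | ht') f g hf hg hfg
    · rw [hφ0 f (hin t ht t' ht' f hf (hfg.left hf)), hφ0 g (hin t ht t' ht' g hg (hfg.right hg)),
        hφ0 _ (hbW t ht), hφ0 _ (hbW t' ht')]
      simp [kdist_self]
    · have h1 := hmono t' t ht g f hg hf (hfg.symm hd)
      rw [hφ0 _ (hbW t ht), hφ2 _ (hAout t' ht')]
      by_cases h3 : W g
      · rw [hφ0 f (h1 h3), hφ0 g h3]
        simp [kdist_self]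
      · by_cases h2 : W f
        · rw [hφ0 f h2, hφ2 g h3]
          simp [kdist_self]
        · rw [hφ2 f h2, hφ2 g h3]
          simp [kdist_self]
    · have h1 := hmono t t' ht' f g hf hg hfg
      rw [hφ2 _ (hAout t ht), hφ0 _ (hbW t' ht')]
      by_cases h2 : W f
      · rw [hφ0 f h2, hφ0 g (h1 h2)]
        simp [kdist_self]
      · by_cases h3 : W g
        · rw [hφ2 f h2, hφ0 g h3]
          simp [kdist_self]
        · rw [hφ2 f h2, hφ2 g h3]
          simp [kdist_self]
    · rw [hφ2 f (hout t ht t' ht' f hf (hfg.left hf)),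
        hφ2 g (hout t ht t' ht' g hg (hfg.right hg)), hφ2 _ (hAout t ht), hφ2 _ (hAout t' ht')]
      simp [kdist_self]
  · obtain ⟨a, ha⟩ := hA
    exact ⟨b₁, a, by simp [hφ, hb₁, hAout a ha]⟩

end TightFn

section BookPeel

/-- The vertices of degree two of `K_{2,3}`. -/
def leafVertex (i : Fin 3) : Fin 5 := i.natAdd 2

lemma kdist_center_leaf (i : Fin 3) : kdist 0 (leafVertex i) = 1 ∧ kdist 1 (leafVertex i) = 1 := by
  have : ∀ i : Fin 3, bipartiteDist 0 (leafVertex i) = 1 ∧ bipartiteDist 1 (leafVertex i) = 1 := by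
    decide
  simp [kdist, this i]

lemma kdist_leaf_leaf {i j : Fin 3} (h : i ≠ j) : kdist (leafVertex i) (leafVertex j) = 2 := by
  have : ∀ i j : Fin 3, i ≠ j → bipartiteDist (leafVertex i) (leafVertex j) = 2 := by decide
  simp [kdist, this i j h]

lemma kdist_centers : kdist 0 1 = 2 := by simp [kdist, bipartiteDist]

variable {K : Type*} {d : K → K → ℝ}

open Classical in
/-- Suppose that `b` lies on a geodesic between any two of the points `y i`, and that it lies on
no geodesic from `a` to some `y i`. Around the point `b` the tight span then looks like that of
`K_{2,3}`, and the geodesics from `b` to the `y i` can be peeled off: `b` is mapped to one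
center, the rest of the geodesic to `y i` to the leaf `i`, and everything else to the other
center. -/
lemma hasPeel_of_center (hd : IsPseudometric d) (a b : K) (y : Fin 3 → K)
    (hcov : ∀ t, d t a = 0 ∨ d t b = 0 ∨ ∃ i, d t (y i) = 0)
    (hy : ∀ i j, i ≠ j → d (y i) (y j) = d b (y i) + d b (y j))
    (ha : ∀ i, d a (y i) < d a b + d b (y i)) : HasPeel d := by
  set φ : (K → ℝ) → Fin 5 := fun f =>
    if f b = 0 then 1 else
    if h : ∃ i, f b + f (y i) = d b (y i) then leafVertex h.choose else 0 with hφ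
  have hother : ∀ i : Fin 3, ∃ j, j ≠ i := by decide
  -- The geodesics from `b` to distinct points `y i` meet only in `b`.
  have hmeet : ∀ f, IsTightFn d f → ∀ i j, i ≠ j → f b + f (y i) = d b (y i) →
      f b + f (y j) = d b (y j) → f b = 0 := by
    intro f hf i j hij h1 h2
    have h3 := hf.le_add (y i) (y j)
    have h4 := hf.nonneg hd b
    rw [hy i j hij] at h3
    linarith
  have htri : ∀ f, IsTightFn d f → (f b = 0 ∧ φ f = 1) ∨
      (f b ≠ 0 ∧ ∃ i, f b + f (y i) = d b (y i) ∧ φ f = leafVertex i) ∨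
      (f b ≠ 0 ∧ (∀ i, f b + f (y i) ≠ d b (y i)) ∧ φ f = 0) := by
    intro f hf
    by_cases h1 : f b = 0
    · exact Or.inl ⟨h1, by simp [hφ, h1]⟩
    · by_cases h2 : ∃ i, f b + f (y i) = d b (y i)
      · refine Or.inr (Or.inl ⟨h1, h2.choose, h2.choose_spec, ?_⟩)
        simp only [hφ, h1, if_false, dif_pos h2]
      · refine Or.inr (Or.inr ⟨h1, not_exists.1 h2, ?_⟩)
        simp only [hφ, h1, if_false, dif_neg h2]
  have hleaf : ∀ f, IsTightFn d f → f b ≠ 0 → ∀ i, f b + f (y i) = d b (y i) →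
      φ f = leafVertex i := by
    intro f hf h0 i hi
    rcases htri f hf with ⟨h, -⟩ | ⟨-, j, hj, h⟩ | ⟨-, h, -⟩
    · exact absurd h h0
    · by_cases hij : i = j
      · rw [hij, h]
      · exact absurd (hmeet f hf i j hij hi hj) h0
    · exact absurd hi (h i)
  have hφb : φ (d b) = 1 := by simp [hφ, hd.refl]
  have hφy : ∀ i, φ (d (y i)) = leafVertex i := by
    intro i
    refine hleaf _ (isTightFn_dist hd _) ?_ i (by rw [hd.refl, add_zero, hd.symm])
    intro h
    have h1 := ha i
    have h2 := hd.triangle a b (y i)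
    have h3 := hd.triangle a (y i) b
    rw [hd.symm] at h
    have h4 := hd.symm (y i) b
    linarith
  have hφa : φ (d a) = 0 := by
    rcases htri _ (isTightFn_dist hd a) with ⟨h, -⟩ | ⟨-, i, h, -⟩ | ⟨-, -, h⟩
    · have h1 := ha 0
      have h2 := hd.triangle b a (y 0)
      rw [hd.symm b a] at h2
      linarith
    · obtain ⟨j, hj⟩ := hother i
      have h1 := hy j i hj
      have h2 := hd.triangle (y j) a (y i)
      have h3 := ha j
      have h4 := hd.symm (y j) a
      linarith
    · exact h
  obtain ⟨k01, kL⟩ := And.intro kdist_centers kdist_center_leaf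
  have k10 : kdist 1 0 = 2 := by rw [kdist_comm, k01]
  have kL0 : ∀ i, kdist (leafVertex i) 0 = 1 := fun i => by rw [kdist_comm, (kL i).1]
  have kL1 : ∀ i, kdist (leafVertex i) 1 = 1 := fun i => by rw [kdist_comm, (kL i).2]
  let P : K → K → Prop := fun t t' => ∀ f g, IsTightFn d f → IsTightFn d g →
    OnGeodesic d t f g t' → kdist (φ (d t)) (φ f) + kdist (φ f) (φ g) + kdist (φ g) (φ (d t')) ≤
        kdist (φ (d t)) (φ (d t'))
  have hPsymm : ∀ t t', P t t' → P t' t := by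
    intro t t' h f g hf hg hfg
    have := h g f hg hf (hfg.symm hd)
    have h1 := kdist_comm (φ (d t')) (φ f)
    have h2 := kdist_comm (φ f) (φ g)
    have h3 := kdist_comm (φ g) (φ (d t))
    have h4 := kdist_comm (φ (d t')) (φ (d t))
    linarith
  have hPrefl : ∀ t, P t t := by
    intro t f g hf hg hfg
    have h1 := hfg.left hf
    have h2 := hfg.right hg
    rw [hd.refl] at h1 h2
    rw [funext (hf.eq_of_zero hd (b := t) (by linarith)),
      funext (hg.eq_of_zero hd (b := t) (by linarith))]
    simp [kdist_self]
  -- On a geodesic that ends in `b`, nothing follows `b`.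
  have hend : ∀ t f g, IsTightFn d f → IsTightFn d g → OnGeodesic d t f g b → f b = 0 →
      g b = 0 := by
    intro t f g hf hg hfg h
    have h1 := hfg.left hf
    obtain ⟨s, h2, h3⟩ := hfg
    have := (abs_nonneg _).trans (h2 b)
    have := hg.nonneg hd b
    linarith
  have hPab : P a b := by
    intro f g hf hg hfg
    rw [hφa, hφb]
    rcases htri f hf with ⟨h1, h2⟩ | ⟨h1, i, h2, h3⟩ | ⟨h1, h2, h3⟩
    · have h4 := hend a f g hf hg hfg h1
      rcases htri g hg with ⟨h5, h6⟩ | ⟨h5, -⟩ | ⟨h5, -⟩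
      · rw [h2, h6]; simp [kdist_self]
      · exact absurd h4 h5
      · exact absurd h4 h5
    · have h4 := hfg.eq_of_eq hf hg h2
      by_cases h5 : g b = 0
      · rcases htri g hg with ⟨-, h6⟩ | ⟨h6, -⟩ | ⟨h6, -⟩
        · rw [h3, h6, kdist_self, (kL i).1, kL1 i, k01]; norm_num
        · exact absurd h5 h6
        · exact absurd h5 h6
      · rw [h3, hleaf g hg h5 i h4, kdist_self, (kL i).1, kL1 i, k01]; norm_num
    · rw [h3, kdist_self, zero_add]
      rcases htri g hg with ⟨-, h4⟩ | ⟨-, i, -, h4⟩ | ⟨-, -, h4⟩ <;> rw [h4]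
      · rw [kdist_self, add_zero]
      · rw [(kL i).1, kL1 i, k01]; norm_num
      · rw [kdist_self, zero_add]
  have hPay : ∀ i, P a (y i) := by
    intro i
    -- Neither `b` nor a point of another geodesic from `b` is on a geodesic from `a` to `y i`.
    have hav : ∀ f, IsTightFn d f → f a + f (y i) = d a (y i) →
        (φ f = leafVertex i ∧ f b + f (y i) = d b (y i)) ∨
        (φ f = 0 ∧ f b + f (y i) ≠ d b (y i)) := by
      intro f hf h
      have h5 := hf.le_add a b
      rcases htri f hf with ⟨h1, -⟩ | ⟨h1, j, h2, h3⟩ | ⟨h1, h2, h3⟩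
      · have h2 := ha i
        have h3 := hf.eq_of_zero hd h1
        rw [h3 a, h3 (y i), hd.symm b a] at h
        linarith
      · by_cases hij : j = i
        · subst hij; exact Or.inl ⟨h3, h2⟩
        · have h4 := hf.le_add (y i) (y j)
          have h6 := hy i j (Ne.symm hij)
          have h7 := ha i
          linarith
      · exact Or.inr ⟨h3, h2 i⟩
    intro f g hf hg hfg
    rw [hφa, hφy]
    rcases hav f hf (hfg.left hf) with ⟨h1, h2⟩ | ⟨h1, h2⟩
    · have h3 := hfg.eq_of_eq (x := b) hf hg (by rw [add_comm, h2, hd.symm])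
      rcases hav g hg (hfg.right hg) with ⟨h4, h5⟩ | ⟨h4, h5⟩
      · rw [h1, h4, kdist_self]; simp
      · exact absurd (by rw [add_comm, h3, hd.symm]) h5
    · rw [h1, kdist_self, zero_add]
      rcases hav g hg (hfg.right hg) with ⟨h4, h5⟩ | ⟨h4, h5⟩ <;> rw [h4, kdist_self] <;> simp
  have hPby : ∀ i, P b (y i) := by
    intro i f g hf hg hfg
    have h1 := hfg.left hf
    have h2 := hfg.right hg
    have h3 := hend (y i) g f hg hf (hfg.symm hd)
    rw [hφb, hφy]
    by_cases hf0 : f b = 0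
    · have h4 : φ f = 1 := by simp [hφ, hf0]
      rw [h4, kdist_self, zero_add]
      by_cases hg0 : g b = 0
      · have h5 : φ g = 1 := by simp [hφ, hg0]
        rw [h5, kdist_self, zero_add]
      · rw [hleaf g hg hg0 i h2, kdist_self, add_zero]
    · have hg0 : g b ≠ 0 := fun h => hf0 (h3 h)
      rw [hleaf g hg hg0 i h2, hleaf f hf hf0 i h1, kdist_self]
      simp
  have hPyy : ∀ i j, i ≠ j → P (y i) (y j) := by
    intro i j hij
    -- A geodesic from `y i` to `y j` avoids the interior of the third geodesic from `b`.
    have hthird : ∀ f, IsTightFn d f → f (y i) + f (y j) = d (y i) (y j) → f b ≠ 0 → ∀ k,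
        f b + f (y k) = d b (y k) → k = i ∨ k = j := by
      intro f hf h h0 k hk
      by_contra hc
      rw [not_or] at hc
      have h1 := hf.le_add (y i) (y k)
      have h2 := hf.le_add (y j) (y k)
      rw [hy i k (Ne.symm hc.1)] at h1
      rw [hy j k (Ne.symm hc.2)] at h2
      rw [hy i j hij] at h
      have h3 := hf.nonneg hd b
      exact h0 (by linarith)
    intro f g hf hg hfg
    have h1 := hfg.left hf
    have h2 := hfg.right hg
    have hfj : f b + f (y j) = d b (y j) → g b + g (y j) = d b (y j) := fun h => by
      have := hfg.eq_of_eq (x := b) hf hg (by rw [add_comm, h, hd.symm])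
      rw [add_comm, this, hd.symm]
    have hgi : g b + g (y i) = d b (y i) → f b + f (y i) = d b (y i) := fun h => by
      have := (hfg.symm hd).eq_of_eq (x := b) hg hf (by rw [add_comm, h, hd.symm])
      rw [add_comm, this, hd.symm]
    have hbj : ∀ f, IsTightFn d f → f b = 0 → ∀ j, f b + f (y j) = d b (y j) := fun f hf h j => by
      rw [h, zero_add, hf.eq_of_zero hd h]
    have kij := kdist_leaf_leaf hij
    have kji := kdist_leaf_leaf hij.symm
    rw [hφy, hφy, kij]
    have hcase : ∀ f, IsTightFn d f → f (y i) + f (y j) = d (y i) (y j) →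
        (f b = 0 ∧ φ f = 1) ∨ (f b ≠ 0 ∧ f b + f (y i) = d b (y i) ∧ φ f = leafVertex i) ∨
        (f b ≠ 0 ∧ f b + f (y j) = d b (y j) ∧ φ f = leafVertex j) ∨
        (f b ≠ 0 ∧ (∀ i, f b + f (y i) ≠ d b (y i)) ∧ φ f = 0) := by
      intro f hf h
      rcases htri f hf with h3 | ⟨h3, k, h4, h5⟩ | h3
      · exact Or.inl h3
      · rcases hthird f hf h h3 k h4 with rfl | rfl
        · exact Or.inr (Or.inl ⟨h3, h4, h5⟩)
        · exact Or.inr (Or.inr (Or.inl ⟨h3, h4, h5⟩))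
      · exact Or.inr (Or.inr (Or.inr h3))
    rcases hcase f hf h1 with ⟨f0, fφ⟩ | ⟨f0, f1, fφ⟩ | ⟨f0, f1, fφ⟩ | ⟨f0, f1, fφ⟩ <;>
    rcases hcase g hg h2 with ⟨g0, gφ⟩ | ⟨g0, g1, gφ⟩ | ⟨g0, g1, gφ⟩ | ⟨g0, g1, gφ⟩
    all_goals
      rw [fφ, gφ]
      try simp only [kdist_self, k01, k10, (kL _).1, (kL _).2, kL0, kL1, kij, kji]
      try norm_num
    · exact g0 (hmeet g hg i j hij g1 (hfj (hbj f hf f0 j)))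
    · exact absurd (hfj (hbj f hf f0 j)) (g1 j)
    · exact f0 (hmeet f hf j i hij.symm f1 (hgi (hbj g hg g0 i)))
    · exact g0 (hmeet g hg i j hij g1 (hfj f1))
    · exact absurd (hfj f1) (g1 j)
    · exact absurd (hgi (hbj g hg g0 i)) (f1 i)
    · exact absurd (hgi g1) (f1 i)
  refine ⟨φ, isGeodesicMap_of_cover hd φ ({a, b} ∪ Set.range y) ?_ ?_, a, b, ?_⟩
  · intro t
    rcases hcov t with h | h | ⟨i, h⟩
    · exact ⟨a, by simp, h⟩
    · exact ⟨b, by simp, h⟩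
    · exact ⟨y i, by simp, h⟩
  · rintro t ((rfl | rfl) | ⟨i, rfl⟩) t' ((rfl | rfl) | ⟨j, rfl⟩)
    · exact hPrefl _
    · exact hPab
    · exact hPay j
    · exact hPsymm _ _ hPab
    · exact hPrefl _
    · exact hPby j
    · exact hPsymm _ _ (hPay i)
    · exact hPsymm _ _ (hPby i)
    · by_cases hij : i = j
      · subst hij; exact hPrefl _
      · exact hPyy i j hij
  · rw [hφa, hφb]
    decide

end BookPeel

/-! ### Every pseudometric on five points has a geodesic map to `K_{2,3}` -/

section FivePoints

variable {K : Type*} {d : K → K → ℝ}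

/-- Up to distance `0`, there are no points of `d` besides the five given ones. -/
def IsCover (d : K → K → ℝ) (b p q r s : K) : Prop :=
  ∀ t, d t b = 0 ∨ d t p = 0 ∨ d t q = 0 ∨ d t r = 0 ∨ d t s = 0

/-- If `b` lies on no geodesic between two other points, then it can be cut off. -/
lemma hasPeel_single (hd : IsPseudometric d) {b p q r s : K} (hcov : IsCover d b p q r s)
    (hp : 0 < d b p) (hq : 0 < d b q) (hr : 0 < d b r) (hs : 0 < d b s)
    (hpq : d p q < d b p + d b q) (hpr : d p r < d b p + d b r) (hps : d p s < d b p + d b s)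
    (hqr : d q r < d b q + d b r) (hqs : d q s < d b q + d b s)
    (hrs : d r s < d b r + d b s) : HasPeel d := by
  have S := hd.symm
  refine hasPeel_of_split hd b b {p, q, r, s} ⟨p, by simp⟩ ?_ ?_
  · intro t
    have := hcov t
    simp only [Set.mem_insert_iff, Set.mem_singleton_iff, exists_eq_or_imp, exists_eq_left]
    tauto
  · intro a ha a' ha'
    left
    rw [hd.refl b, S a b, S a' b, add_zero]
    rcases ha with rfl | rfl | rfl | rfl <;> rcases ha' with rfl | rfl | rfl | rfl <;>
      first
        | (rw [hd.refl]; linarith)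
        | linarith
        | (rw [S]; linarith)

/-- The split that separates `b₁` and `b₂` from the other three points gives a cut if its
isolation index is positive. -/
lemma hasPeel_pair (hd : IsPseudometric d) {b₁ b₂ p q r : K} (hcov : IsCover d b₁ b₂ p q r)
    (hp : d b₁ b₂ < d b₁ p + d b₂ p) (hq : d b₁ b₂ < d b₁ q + d b₂ q)
    (hr : d b₁ b₂ < d b₁ r + d b₂ r)
    (hpq : d p q + d b₁ b₂ < d b₁ p + d b₂ q ∨ d p q + d b₁ b₂ < d b₂ p + d b₁ q)
    (hpr : d p r + d b₁ b₂ < d b₁ p + d b₂ r ∨ d p r + d b₁ b₂ < d b₂ p + d b₁ r)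
    (hqr : d q r + d b₁ b₂ < d b₁ q + d b₂ r ∨ d q r + d b₁ b₂ < d b₂ q + d b₁ r) :
    HasPeel d := by
  have S := hd.symm
  refine hasPeel_of_split hd b₁ b₂ {p, q, r} ⟨p, by simp⟩ ?_ ?_
  · intro t
    have := hcov t
    simp only [Set.mem_insert_iff, Set.mem_singleton_iff, exists_eq_or_imp, exists_eq_left]
    tauto
  · intro a ha a' ha'
    rw [S a b₁, S a b₂, S a' b₁, S a' b₂]
    rcases ha with rfl | rfl | rfl <;> rcases ha' with rfl | rfl | rfl
    · left; rw [hd.refl]; linarith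
    · exact hpq
    · exact hpr
    · rw [S a a', add_comm (d b₁ a), add_comm (d b₂ a)]; exact hpq.symm
    · left; rw [hd.refl]; linarith
    · exact hqr
    · rw [S a a', add_comm (d b₁ a), add_comm (d b₂ a)]; exact hpr.symm
    · rw [S a a', add_comm (d b₁ a), add_comm (d b₂ a)]; exact hqr.symm
    · left; rw [hd.refl]; linarith

/-- The case that `b` lies on geodesics between `q`, `r` and `s`, but not from `p` to one of
them. -/
lemma hasPeel_triangle (hd : IsPseudometric d) {b p q r s : K} (hcov : IsCover d b p q r s)
    (hqr : d q r = d b q + d b r) (hqs : d q s = d b q + d b s) (hrs : d r s = d b r + d b s)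
    (hpq : d p q < d b p + d b q) (hpr : d p r < d b p + d b r) (hps : d p s < d b p + d b s) :
    HasPeel d := by
  have S := hd.symm
  refine hasPeel_of_center hd p b ![q, r, s] ?_ ?_ ?_
  · intro t
    have := hcov t
    simp only [Fin.exists_fin_succ]
    simp
    tauto
  · intro i j
    fin_cases i <;> fin_cases j <;> simp <;> linarith [S q r, S q s, S r s]
  · intro i
    fin_cases i <;> simp <;> linarith [S p b]

/-- The case that `b` lies on geodesics from `p` to `q` and from `r` to `s`, but on none from `p`
to `r` or from `q` to `s`. -/
lemma hasPeel_matching (hd : IsPseudometric d) {b p q r s : K} (hcov : IsCover d b p q r s)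
    (hpq : d p q = d b p + d b q) (hrs : d r s = d b r + d b s)
    (hpr : d p r < d b p + d b r) (hqs : d q s < d b q + d b s) : HasPeel d := by
  have S := hd.symm
  have T := hd.triangle
  refine hasPeel_pair hd (b₁ := p) (b₂ := r) (p := b) (q := q) (r := s) ?_ ?_ ?_ ?_ ?_ ?_ ?_
  · intro t; have := hcov t; tauto
  · linarith [S p b, S r b]
  · linarith [T b q r, S q r]
  · linarith [T b s p, S s p]
  · right; linarith [S r b]
  · left; linarith [S p b]
  · left; linarith

/-- The case that `b` lies on geodesics from `p` to all other points. -/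
lemma hasPeel_dominating (hd : IsPseudometric d) {b p q r s : K} (hcov : IsCover d b p q r s)
    (hp : 0 < d b p)
    (hpq : d p q = d b p + d b q) (hpr : d p r = d b p + d b r) (hps : d p s = d b p + d b s) :
    HasPeel d := by
  have S := hd.symm
  have T := hd.triangle
  have N := hd.nonneg
  refine hasPeel_single hd (b := p) (p := b) (q := q) (r := r) (s := s) ?_ ?_ ?_ ?_ ?_
    ?_ ?_ ?_ ?_ ?_ ?_
  · intro t; have := hcov t; tauto
  · linarith [S p b]
  · linarith [N b q]
  · linarith [N b r]
  · linarith [N b s]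
  · linarith [S p b]
  · linarith [S p b]
  · linarith [S p b]
  · linarith [T q b r, S q b]
  · linarith [T q b s, S q b]
  · linarith [T r b s, S r b]

/-- The case that, among the four other points, `b` lies on a geodesic between `p` and `q` only.
If none of the splits `{b, p}`, `{b, q}` and none of the points `p`, `q`, `r`, `s` can be cut off,
then `p`, `r`, `q`, `s` are the corners of a rectangle, of which one of the two splits
`{p, r}`, `{p, s}` works, unless `p` lies on geodesics between any two of `b`, `r`, `s`. -/
lemma hasPeel_edge (hd : IsPseudometric d) {b p q r s : K} (hcov : IsCover d b p q r s)
    (hp : 0 < d b p) (hq : 0 < d b q) (hr : 0 < d b r) (hs : 0 < d b s)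
    (hpq : d p q = d b p + d b q) (hpr : d p r < d b p + d b r) (hps : d p s < d b p + d b s)
    (hqr : d q r < d b q + d b r) (hqs : d q s < d b q + d b s) : HasPeel d := by
  have S := hd.symm
  have T := hd.triangle
  -- `r` and `s` are not on geodesics from `b` to `p` or `q`.
  have bpr : d b p < d b r + d p r := by linarith [T p r q, S r q]
  have bps : d b p < d b s + d p s := by linarith [T p s q, S s q]
  have bqr : d b q < d b r + d q r := by linarith [T p r q, S r q]
  have bqs : d b q < d b s + d q s := by linarith [T p s q, S s q]
  have pr0 : 0 < d p r := by linarith [T b p r]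
  have ps0 : 0 < d p s := by linarith [T b p s]
  have qr0 : 0 < d q r := by linarith [T b q r]
  have qs0 : 0 < d q s := by linarith [T b q s]
  -- The split `{b, p}`.
  by_cases c1 : d b p + d r s < d b r + d p s ∨ d b p + d r s < d b s + d p r
  · refine hasPeel_pair hd (b₁ := b) (b₂ := p) (p := q) (q := r) (r := s) ?_ ?_ ?_ ?_ ?_ ?_ ?_
    · intro t; have := hcov t; tauto
    · linarith
    · linarith
    · linarith
    · right; linarith
    · right; linarith
    · exact c1.imp (fun h => by linarith) (fun h => by linarith)
  -- The split `{b, q}`.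
  by_cases c2 : d b q + d r s < d b r + d q s ∨ d b q + d r s < d b s + d q r
  · refine hasPeel_pair hd (b₁ := b) (b₂ := q) (p := p) (q := r) (r := s) ?_ ?_ ?_ ?_ ?_ ?_ ?_
    · intro t; have := hcov t; tauto
    · linarith [S p q]
    · linarith
    · linarith
    · right; linarith [S p q]
    · right; linarith [S p q]
    · exact c2.imp (fun h => by linarith) (fun h => by linarith)
  simp only [not_or, not_lt] at c1 c2
  -- Cutting off one of the points `p`, `q`, `r`, `s`.
  rcases (T r p s).lt_or_eq with c3 | c3
  · refine hasPeel_single hd (b := p) (p := b) (q := q) (r := r) (s := s) ?_ ?_ ?_ ?_ ?_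
      ?_ ?_ ?_ ?_ ?_ ?_
    · intro t; have := hcov t; tauto
    all_goals linarith [S p b, S r p, T b p r, T b p s]
  rcases (T r q s).lt_or_eq with c4 | c4
  · refine hasPeel_single hd (b := q) (p := b) (q := p) (r := r) (s := s) ?_ ?_ ?_ ?_ ?_
      ?_ ?_ ?_ ?_ ?_ ?_
    · intro t; have := hcov t; tauto
    all_goals linarith [S q b, S r q, S q p, T b q r, T b q s]
  rcases (T p r q).lt_or_eq with c5 | c5
  · refine hasPeel_single hd (b := r) (p := b) (q := p) (r := q) (s := s) ?_ ?_ ?_ ?_ ?_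
      ?_ ?_ ?_ ?_ ?_ ?_
    · intro t; have := hcov t; tauto
    all_goals linarith [S r b, S r q, S r p, T b p s]
  rcases (T p s q).lt_or_eq with c6 | c6
  · refine hasPeel_single hd (b := s) (p := b) (q := p) (r := q) (s := r) ?_ ?_ ?_ ?_ ?_
      ?_ ?_ ?_ ?_ ?_ ?_
    · intro t; have := hcov t; tauto
    all_goals linarith [S s b, S s q, S s p, S s r, S r p, S r q, T b p r]
  -- Now `p`, `r`, `q`, `s` form a rectangle; the splits `{p, r}` and `{p, s}` are parallel to its
  -- sides.
  rcases (T b p s).lt_or_eq with c7 | c7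
  · refine hasPeel_pair hd (b₁ := p) (b₂ := r) (p := b) (q := q) (r := s) ?_ ?_ ?_ ?_ ?_ ?_ ?_
    · intro t; have := hcov t; tauto
    · linarith [S p b, S r b]
    · linarith [S r q]
    · linarith [S r p]
    · right; linarith [S r b]
    · left; linarith [S p b, S r p]
    · left; linarith [S r p, S r q, S s q]
  rcases (T b p r).lt_or_eq with c8 | c8
  · refine hasPeel_pair hd (b₁ := p) (b₂ := s) (p := b) (q := q) (r := r) ?_ ?_ ?_ ?_ ?_ ?_ ?_
    · intro t; have := hcov t; tauto
    · linarith [S p b, S s b]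
    · linarith [S s q]
    · linarith [S r p, S s r]
    · right; linarith [S s b]
    · left; linarith [S p b, S r p, S s r]
    · left; linarith [S r p, S r q, S s q, S s r]
  refine hasPeel_triangle hd (b := p) (p := q) (q := b) (r := r) (s := s) ?_ ?_ ?_ ?_ ?_ ?_ ?_
  · intro t; have := hcov t; tauto
  all_goals linarith [S p b, S r p, S q b, S q p]

/-- The case that, among the four other points, `b` lies on geodesics from `q` to `p` and to `r`
only. Either `q` can be cut off, or `q` lies on a geodesic between `b` and `s` only, which is the
case of a single edge at the point `q`. -/
lemma hasPeel_path (hd : IsPseudometric d) {b p q r s : K} (hcov : IsCover d b p q r s)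
    (hp : 0 < d b p) (hq : 0 < d b q) (hr : 0 < d b r)
    (hpq : d p q = d b p + d b q) (hqr : d q r = d b q + d b r)
    (hpr : d p r < d b p + d b r) (hps : d p s < d b p + d b s)
    (hrs : d r s < d b r + d b s) : HasPeel d := by
  have S := hd.symm
  have T := hd.triangle
  have qs0 : 0 < d q s := by linarith [T p s q, T b q s, S s q]
  rcases (T b q s).lt_or_eq with c | c
  · refine hasPeel_single hd (b := q) (p := b) (q := p) (r := r) (s := s) ?_ ?_ ?_ ?_ ?_
      ?_ ?_ ?_ ?_ ?_ ?_
    · intro t; have := hcov t; tauto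
    all_goals linarith [S q b, S q p]
  · refine hasPeel_edge hd (b := q) (p := b) (q := s) (r := p) (s := r) ?_ ?_ ?_ ?_ ?_
      ?_ ?_ ?_ ?_ ?_
    · intro t; have := hcov t; tauto
    all_goals linarith [S q b, S q p, S s p, S s r]


/-- The graphs on four vertices: with a suitable ordering `i, j, k, l` of the vertices, the graph
is empty, a single edge, a path of two edges, a triangle, or it contains a perfect matching
`ij, kl` but neither `ik` nor `jl`, or it has a vertex `i` joined to all others. -/
lemma graph_on_four (e₀₁ e₀₂ e₀₃ e₁₂ e₁₃ e₂₃ : Bool) :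
    let e : Fin 4 → Fin 4 → Bool := ![![false, e₀₁, e₀₂, e₀₃], ![e₀₁, false, e₁₂, e₁₃],
      ![e₀₂, e₁₂, false, e₂₃], ![e₀₃, e₁₃, e₂₃, false]]
    ∃ i j k l : Fin 4, (∀ m, m = i ∨ m = j ∨ m = k ∨ m = l) ∧
      ((!e i j && !e i k && !e i l && !e j k && !e j l && !e k l) ||
      (e i j && !e i k && !e i l && !e j k && !e j l && !e k l) ||
      (e i j && !e i k && !e i l && e j k && !e k l) ||
      (!e i j && !e i k && !e i l && e j k && e j l && e k l) ||
      (e i j && !e i k && !e j l && e k l) ||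
      (e i j && e i k && e i l)) = true := by
  revert e₀₁ e₀₂ e₀₃ e₁₂ e₁₃ e₂₃
  decide +kernel

/-- A geodesic map exists if `b` has positive distance to the four other points, which need not be
distinct: the graph on these points in which `i` and `j` are adjacent if `b` lies on a geodesic
between them is one of those of `graph_on_four`. -/
lemma hasPeel_of_cover (hd : IsPseudometric d) {b : K} {x : Fin 4 → K}
    (hcov : ∀ t, d t b = 0 ∨ ∃ i, d t (x i) = 0) (hpos : ∀ i, 0 < d b (x i)) : HasPeel d := by
  classical
  let E : Fin 4 → Fin 4 → Bool := fun i j => decide (d (x i) (x j) = d b (x i) + d b (x j))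
  have hE : ∀ i j, E i j = true → d (x i) (x j) = d b (x i) + d b (x j) := fun i j h =>
    of_decide_eq_true h
  have hE' : ∀ i j, E i j = false → d (x i) (x j) < d b (x i) + d b (x j) := fun i j h => by
    refine lt_of_le_of_ne ?_ (of_decide_eq_false h)
    have := hd.triangle (x i) b (x j)
    rwa [hd.symm (x i) b] at this
  have hsymm : ∀ i j, E i j = E j i := fun i j => by
    simp only [E, hd.symm (x i) (x j), add_comm]
  have hdiag : ∀ i, E i i = false := fun i => by
    refine decide_eq_false ?_
    have := hpos i
    rw [hd.refl]
    linarith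
  obtain ⟨i, j, k, l, hm, h⟩ := graph_on_four (E 0 1) (E 0 2) (E 0 3) (E 1 2) (E 1 3) (E 2 3)
  have he : ![![false, E 0 1, E 0 2, E 0 3], ![E 0 1, false, E 1 2, E 1 3],
      ![E 0 2, E 1 2, false, E 2 3], ![E 0 3, E 1 3, E 2 3, false]] = E := by
    funext m n
    fin_cases m <;> fin_cases n <;> first | rfl | exact (hdiag _).symm | exact hsymm _ _
  have hc : IsCover d b (x i) (x j) (x k) (x l) := by
    intro t
    rcases hcov t with h | ⟨m, h⟩
    · exact Or.inl h
    · rcases hm m with rfl | rfl | rfl | rfl <;> tauto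
  simp only [he, Bool.or_eq_true, Bool.and_eq_true, Bool.not_eq_true'] at h
  rcases h with ((((⟨⟨⟨⟨⟨h1, h2⟩, h3⟩, h4⟩, h5⟩, h6⟩ | ⟨⟨⟨⟨⟨h1, h2⟩, h3⟩, h4⟩, h5⟩, h6⟩) |
    ⟨⟨⟨⟨h1, h2⟩, h3⟩, h4⟩, h5⟩) | ⟨⟨⟨⟨⟨h1, h2⟩, h3⟩, h4⟩, h5⟩, h6⟩) | ⟨⟨⟨h1, h2⟩, h3⟩, h4⟩) |
    ⟨⟨h1, h2⟩, h3⟩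
  · exact hasPeel_single hd hc (hpos i) (hpos j) (hpos k) (hpos l) (hE' _ _ h1) (hE' _ _ h2)
      (hE' _ _ h3) (hE' _ _ h4) (hE' _ _ h5) (hE' _ _ h6)
  · exact hasPeel_edge hd hc (hpos i) (hpos j) (hpos k) (hpos l) (hE _ _ h1) (hE' _ _ h2)
      (hE' _ _ h3) (hE' _ _ h4) (hE' _ _ h5)
  · exact hasPeel_path hd hc (hpos i) (hpos j) (hpos k) (hE _ _ h1) (hE _ _ h4)
      (hE' _ _ h2) (hE' _ _ h3) (hE' _ _ h5)
  · exact hasPeel_triangle hd hc (hE _ _ h4) (hE _ _ h5) (hE _ _ h6) (hE' _ _ h1)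
      (hE' _ _ h2) (hE' _ _ h3)
  · exact hasPeel_matching hd hc (hE _ _ h1) (hE _ _ h4) (hE' _ _ h2) (hE' _ _ h3)
  · exact hasPeel_dominating hd hc (hpos i) (hE _ _ h1) (hE _ _ h2) (hE _ _ h3)

/-- A nonzero pseudometric on five points has a geodesic map that separates two of them. -/
theorem exists_peel [Fintype K] (hK : Fintype.card K = 5) (hd : IsPseudometric d)
    (h0 : ∃ t t', d t t' ≠ 0) : HasPeel d := by
  classical
  obtain ⟨b, u, hbu⟩ := h0
  have hbu : 0 < d b u := lt_of_le_of_ne (hd.nonneg b u) hbu.symm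
  have hcard : Fintype.card {t : K // t ≠ b} = 4 := by
    rw [Fintype.card_subtype_compl, hK]; simp
  let σ := (Fintype.equivFinOfCardEq hcard).symm
  -- Points at distance `0` from `b` are replaced by another copy of `u`.
  refine hasPeel_of_cover hd (b := b) (x := fun i => if d b (σ i) = 0 then u else (σ i : K)) ?_ ?_
  · intro t
    by_cases ht : d t b = 0
    · exact Or.inl ht
    · have htb : t ≠ b := by rintro rfl; exact ht (hd.refl _)
      refine Or.inr ⟨σ.symm ⟨t, htb⟩, ?_⟩
      rw [Equiv.apply_symm_apply, if_neg (by rwa [hd.symm]), hd.refl]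
  · intro i
    split_ifs with h
    · exact hbu
    · exact lt_of_le_of_ne (hd.nonneg _ _) (Ne.symm h)
end FivePoints

/-! ### From maps to `K_{2,3}` to arbitrary pseudometrics -/

section Potential

open Filter Topology

variable {V K ι : Type*}

/-- A pseudometric on the terminals `K`, placed at the vertices `τ`, together with a point of its
injective hull for every vertex: `F v t` is the distance from the vertex `v` to the terminal `t`.
Distances between other pairs of vertices are measured in the supremum norm of `K → ℝ`. -/
structure IsPotential (τ : K → V) (F : V → K → ℝ) : Prop where
  refl : ∀ t, F (τ t) t = 0
  symm : ∀ t t', F (τ t) t' = F (τ t') t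
  le_add : ∀ v t t', F (τ t) t' ≤ F v t + F v t'

lemma IsPotential.isPseudometric {τ : K → V} {F : V → K → ℝ} (hF : IsPotential τ F) :
    IsPseudometric fun t t' => F (τ t) t' where
  refl := hF.refl
  symm := hF.symm
  triangle t s t' := by
    have := hF.le_add (τ s) t t'
    rw [hF.symm s t] at this
    exact this

lemma IsPotential.nonneg {τ : K → V} {F : V → K → ℝ} (hF : IsPotential τ F) (v : V) (t : K) :
    0 ≤ F v t := by
  have := hF.le_add v t t
  rw [hF.refl] at this
  linarith

variable [Fintype K] [Fintype ι]

/-- The cost of a potential in a network with edge weights `w` and demands `D`: the weighted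
length of the edges minus the demand-weighted distance of the terminals. -/
def potentialValue (src tgt : ι → V) (w : ι → ℝ) (D : K → K → ℝ) (τ : K → V) (F : V → K → ℝ) : ℝ :=
  ∑ e, w e * ‖F (src e) - F (tgt e)‖ - ∑ t, ∑ t', D t t' * F (τ t) t'

/-- The sum of all distances between terminals. -/
def potentialMass (τ : K → V) (F : V → K → ℝ) : ℝ := ∑ t, ∑ t', F (τ t) t'

lemma IsPotential.le_mass {τ : K → V} {F : V → K → ℝ} (hF : IsPotential τ F) (t t' : K) :
    F (τ t) t' ≤ potentialMass τ F :=
  (Finset.single_le_sum (f := fun t' => F (τ t) t') (fun _ _ => hF.nonneg _ _)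
    (Finset.mem_univ t')).trans
    (Finset.single_le_sum (f := fun t => ∑ t', F (τ t) t')
      (fun _ _ => Finset.sum_nonneg fun _ _ => hF.nonneg _ _) (Finset.mem_univ t))

lemma IsPotential.mass_nonneg {τ : K → V} {F : V → K → ℝ} (hF : IsPotential τ F) :
    0 ≤ potentialMass τ F :=
  Finset.sum_nonneg fun _ _ => Finset.sum_nonneg fun _ _ => hF.nonneg _ _

/-- A map of the vertices that does not increase distances and keeps the terminals in place does
not increase the value. -/
lemma potentialValue_mono {src tgt : ι → V} {w : ι → ℝ} (hw : ∀ e, 0 ≤ w e) {D : K → K → ℝ}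
    {τ : K → V} {F G : V → K → ℝ} (hτ : ∀ t, G (τ t) = F (τ t))
    (h : ∀ u v t, |G u t - G v t| ≤ ‖F u - F v‖) :
    potentialValue src tgt w D τ G ≤ potentialValue src tgt w D τ F := by
  unfold potentialValue
  simp only [hτ]
  gcongr with e
  · exact hw e
  · rw [pi_norm_le_iff_of_nonneg (norm_nonneg _)]
    exact fun t => h _ _ t

/-- A linear inequality with nonnegative slack persists under small perturbations that do not
violate it when it is tight. -/
lemma eventually_mul_le {A B : ℝ} (hA : 0 ≤ A) (h : A = 0 → B ≤ 0) :
    ∀ᶠ ε in 𝓝[>] (0 : ℝ), ε * B ≤ A := by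
  rcases hA.eq_or_lt with h0 | h0
  · filter_upwards [self_mem_nhdsWithin] with ε hε
    rw [← h0]
    exact mul_nonpos_of_nonneg_of_nonpos (le_of_lt hε) (h h0.symm)
  · have : Tendsto (fun ε : ℝ => ε * B) (𝓝[>] 0) (𝓝 0) := by
      have : Tendsto (fun ε : ℝ => ε * B) (𝓝 0) (𝓝 (0 * B)) := tendsto_id.mul_const B
      rw [zero_mul] at this
      exact this.mono_left nhdsWithin_le_nhds
    exact (this.eventually (gt_mem_nhds h0)).mono fun ε h => le_of_lt h

/-- The potentials of mass `1` with values at most `1`. -/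
def potentialSet (τ : K → V) : Set (V → K → ℝ) :=
  {F | IsPotential τ F ∧ potentialMass τ F = 1 ∧ ∀ v t, F v t ≤ 1}

lemma isCompact_potentialSet [Finite V] (τ : K → V) : IsCompact (potentialSet τ) := by
  have := Fintype.ofFinite V
  refine (isCompact_Icc (a := (0 : V → K → ℝ)) (b := 1)).of_isClosed_subset ?_ ?_
  · have : potentialSet τ = {F | (∀ t, F (τ t) t = 0) ∧ (∀ t t', F (τ t) t' = F (τ t') t) ∧
        (∀ v t t', F (τ t) t' ≤ F v t + F v t') ∧ ∑ t, ∑ t', F (τ t) t' = 1 ∧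
        ∀ v t, F v t ≤ 1} := by
      ext F
      constructor
      · rintro ⟨⟨h1, h2, h3⟩, h4, h5⟩
        exact ⟨h1, h2, h3, h4, h5⟩
      · rintro ⟨h1, h2, h3, h4, h5⟩
        exact ⟨⟨h1, h2, h3⟩, h4, h5⟩
    rw [this]
    simp only [Set.ofPred_and, Set.ofPred_forall]
    refine (isClosed_iInter fun t => ?_).inter ((isClosed_iInter fun t => isClosed_iInter fun t' =>
      ?_).inter ((isClosed_iInter fun v => isClosed_iInter fun t => isClosed_iInter fun t' =>
      ?_).inter (IsClosed.inter ?_ (isClosed_iInter fun v => isClosed_iInter fun t => ?_))))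
    · exact isClosed_eq (by fun_prop) (by fun_prop)
    · exact isClosed_eq (by fun_prop) (by fun_prop)
    · exact isClosed_le (by fun_prop) (by fun_prop)
    · exact isClosed_eq (by fun_prop) (by fun_prop)
    · exact isClosed_le (by fun_prop) (by fun_prop)
  · exact fun F hF => ⟨fun v t => hF.1.nonneg v t, fun v t => hF.2.2 v t⟩

/-- Truncating at the mass and scaling to mass `1`. -/
lemma IsPotential.exists_normalized {src tgt : ι → V} {w : ι → ℝ} (hw : ∀ e, 0 ≤ w e)
    {D : K → K → ℝ} {τ : K → V} {F : V → K → ℝ} (hF : IsPotential τ F)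
    (h0 : 0 < potentialMass τ F) :
    ∃ G ∈ potentialSet τ, potentialMass τ F * potentialValue src tgt w D τ G ≤
      potentialValue src tgt w D τ F := by
  set M := potentialMass τ F with hM
  set H : V → K → ℝ := fun v t => min (F v t) M with hH
  have hHτ : ∀ t, H (τ t) = F (τ t) := fun t => funext fun t' => min_eq_left (hF.le_mass t t')
  have hval : potentialValue src tgt w D τ H ≤ potentialValue src tgt w D τ F := by
    refine potentialValue_mono hw hHτ fun u v t => ?_
    exact (abs_inf_sub_inf_le_abs _ _ _).trans (norm_le_pi_norm (F u - F v) t)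
  have hHadd : ∀ v t t', H (τ t) t' ≤ H v t + H v t' := by
    intro v t t'
    rw [hHτ]
    have h1 := hF.le_mass t t'
    have h2 := hF.le_add v t t'
    have h3 := hF.nonneg v t
    have h4 := hF.nonneg v t'
    rcases min_cases (F v t) M with h | h <;> rcases min_cases (F v t') M with h' | h' <;>
      simp only [hH, h.1, h'.1] <;> linarith
  refine ⟨fun v t => M⁻¹ * H v t, ⟨⟨fun t => ?_, fun t t' => ?_, fun v t t' => ?_⟩, ?_,
    fun v t => ?_⟩, ?_⟩
  · rw [hHτ, hF.refl, mul_zero]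
  · rw [hHτ, hHτ, hF.symm]
  · rw [← mul_add]
    exact mul_le_mul_of_nonneg_left (hHadd v t t') (inv_nonneg.2 h0.le)
  · simp only [potentialMass, ← Finset.mul_sum, hHτ]
    exact inv_mul_cancel₀ h0.ne'
  · rw [inv_mul_le_iff₀ h0, mul_one]
    exact min_le_right _ _
  · refine le_trans (le_of_eq ?_) hval
    have h1 : ∀ u v, ‖(fun t => M⁻¹ * H u t) - fun t => M⁻¹ * H v t‖ = M⁻¹ * ‖H u - H v‖ := by
      intro u v
      have : ((fun t => M⁻¹ * H u t) - fun t => M⁻¹ * H v t) = M⁻¹ • (H u - H v) := by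
        funext t
        simp [mul_sub]
      rw [this, norm_smul, Real.norm_of_nonneg (inv_nonneg.2 h0.le)]
    simp only [potentialValue, h1, mul_sub, Finset.mul_sum]
    congr 1
    · refine Finset.sum_congr rfl fun e _ => ?_
      field_simp
    · refine Finset.sum_congr rfl fun t _ => Finset.sum_congr rfl fun t' _ => ?_
      field_simp

/-- Averaging a potential with its conjugate `t ↦ max_{t'} (d t t' - F v t')` is a contraction
that keeps the terminals in place. A potential that it does not decrease consists of points of
the tight span. -/
lemma IsPotential.exists_retract [Nonempty K] {τ : K → V} {F : V → K → ℝ} (hF : IsPotential τ F) :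
    ∃ G, IsPotential τ G ∧ (∀ t, G (τ t) = F (τ t)) ∧ (∀ v t, G v t ≤ F v t) ∧
      (∀ u v t, |G u t - G v t| ≤ ‖F u - F v‖) ∧
      ((∀ v t, G v t = F v t) → ∀ v, IsTightFn (fun t t' => F (τ t) t') (F v)) := by
  set S : V → K → ℝ := fun v t =>
    Finset.univ.sup' Finset.univ_nonempty fun t' => F (τ t) t' - F v t' with hS
  have hle : ∀ v t t', F (τ t) t' - F v t' ≤ S v t := fun v t t' =>
    Finset.le_sup' (fun t' => F (τ t) t' - F v t') (Finset.mem_univ t')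
  have hSF : ∀ v t, S v t ≤ F v t := fun v t =>
    Finset.sup'_le _ _ fun t' _ => by linarith [hF.le_add v t t']
  have hSτ : ∀ s t, S (τ s) t = F (τ s) t := by
    intro s t
    refine le_antisymm (hSF _ _) ?_
    have := hle (τ s) t s
    rw [hF.refl, sub_zero, hF.symm] at this
    exact this
  have hSlip : ∀ u v t, S u t - S v t ≤ ‖F u - F v‖ := by
    intro u v t
    rw [sub_le_iff_le_add]
    refine Finset.sup'_le _ _ fun t' _ => ?_
    have h1 := hle v t t'
    have h2 := norm_le_pi_norm (F u - F v) t'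
    have h3 := neg_abs_le ((F u - F v) t')
    simp only [Pi.sub_apply, Real.norm_eq_abs] at h2 h3
    linarith
  have hτ : ∀ t, (fun t' => (F (τ t) t' + S (τ t) t') / 2) = F (τ t) := fun t => funext fun t' => by
    rw [hSτ]; ring
  have hτ' : ∀ t t', (F (τ t) t' + S (τ t) t') / 2 = F (τ t) t' := fun t t' => congrFun (hτ t) t'
  refine ⟨fun v t => (F v t + S v t) / 2, ⟨fun t => ?_, fun t t' => ?_, fun v t t' => ?_⟩, hτ,
    fun v t => ?_, fun u v t => ?_, fun h v => ⟨hF.le_add v, fun t => ?_⟩⟩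
  · rw [hτ', hF.refl]
  · rw [hτ', hτ', hF.symm]
  · rw [hτ']
    have h1 := hle v t t'
    have h2 := hle v t' t
    rw [hF.symm t' t] at h2
    linarith
  · linarith [hSF v t]
  · have h1 := hSlip u v t
    have h2 := hSlip v u t
    rw [norm_sub_rev] at h2
    have h3 := norm_le_pi_norm (F u - F v) t
    rw [Pi.sub_apply, Real.norm_eq_abs, abs_le] at h3
    rw [abs_le]
    constructor <;> linarith [h3.1, h3.2]
  · obtain ⟨t', -, h'⟩ := Finset.exists_mem_eq_sup' (s := Finset.univ) Finset.univ_nonempty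
      fun t' => F (τ t) t' - F v t'
    have h1 := h v t
    have h2 : S v t = F (τ t) t' - F v t' := h'
    exact ⟨t', by linarith⟩

end Potential

section Extremal

open Filter Topology

variable {V K ι : Type*} [Fintype K] [Fintype ι]

/-- At a potential all of whose points lie in the tight span, a small multiple of the pseudometric
induced by a geodesic map can be subtracted: the result is a potential, and every edge becomes
shorter by at least the corresponding multiple of its length in `K_{2,3}`. -/
lemma IsPotential.eventually_sub [Finite V] {τ : K → V} {F : V → K → ℝ} (hF : IsPotential τ F)
    (hT : ∀ v, IsTightFn (fun t t' => F (τ t) t') (F v)) {φ : (K → ℝ) → Fin 5}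
    (hφ : IsGeodesicMap (fun t t' => F (τ t) t') φ) :
    ∀ᶠ ε in 𝓝[>] (0 : ℝ),
      IsPotential τ (fun v t => F v t - ε * kdist (φ (F (τ t))) (φ (F v))) ∧
      ∀ u v, ‖(fun t => F u t - ε * kdist (φ (F (τ t))) (φ (F u))) -
          fun t => F v t - ε * kdist (φ (F (τ t))) (φ (F v))‖ ≤
        ‖F u - F v‖ - ε * kdist (φ (F u)) (φ (F v)) := by
  have h1 : ∀ᶠ ε in 𝓝[>] (0 : ℝ), ∀ v t t', ε * (kdist (φ (F (τ t))) (φ (F v)) +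
      kdist (φ (F (τ t'))) (φ (F v)) - kdist (φ (F (τ t))) (φ (F (τ t')))) ≤
        F v t + F v t' - F (τ t) t' := by
    simp only [eventually_all]
    intro v t t'
    refine eventually_mul_le (sub_nonneg.2 (hF.le_add v t t')) fun h => ?_
    have := hφ t t' (F v) (F v) (hT v) (hT v) ⟨0, by simp, by linarith⟩
    rw [kdist_self, kdist_comm (φ (F v))] at this
    linarith
  have h2 : ∀ᶠ ε in 𝓝[>] (0 : ℝ), ∀ u v t, ε * (kdist (φ (F u)) (φ (F v)) +
      kdist (φ (F (τ t))) (φ (F v)) - kdist (φ (F (τ t))) (φ (F u))) ≤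
        ‖F u - F v‖ - (F u t - F v t) := by
    simp only [eventually_all]
    intro u v t
    have hn : ∀ t, |F v t - F u t| ≤ ‖F u - F v‖ := fun t => by
      rw [norm_sub_rev]; exact norm_le_pi_norm (F v - F u) t
    have hn' := (abs_le.1 (hn t)).1
    refine eventually_mul_le (by linarith) fun h => ?_
    -- The tight partner of `t` at `u` extends the geodesic from `t` over `v` to `u`.
    obtain ⟨t', ht'⟩ := (hT u).exists_eq t
    have h3 := hφ t t' (F v) (F u) (hT v) (hT u) ⟨‖F u - F v‖, hn, by linarith⟩
    have h4 := kdist_triangle (φ (F (τ t))) (φ (F u)) (φ (F (τ t')))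
    have h5 := kdist_comm (φ (F u)) (φ (F v))
    linarith
  have h3 : ∀ᶠ ε in 𝓝[>] (0 : ℝ), ∀ u v, ε * kdist (φ (F u)) (φ (F v)) ≤ ‖F u - F v‖ := by
    simp only [eventually_all]
    intro u v
    refine eventually_mul_le (norm_nonneg _) fun h => ?_
    rw [sub_eq_zero.1 (norm_eq_zero.1 h), kdist_self]
  filter_upwards [h1, h2, h3] with ε h1 h2 h3
  refine ⟨⟨fun t => ?_, fun t t' => ?_, fun v t t' => ?_⟩, fun u v => ?_⟩
  · rw [kdist_self, hF.refl]; simp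
  · rw [hF.symm, kdist_comm]
  · have := h1 v t t'
    rw [kdist_comm (φ (F (τ t'))) (φ (F (τ t)))]
    linarith
  · rw [pi_norm_le_iff_of_nonneg (sub_nonneg.2 (h3 u v))]
    intro t
    have h4 := h2 u v t
    have h5 := h2 v u t
    rw [norm_sub_rev, kdist_comm (φ (F v)) (φ (F u))] at h5
    rw [Pi.sub_apply, Real.norm_eq_abs, abs_le]
    constructor <;> linarith

variable {src tgt : ι → V} {w : ι → ℝ} {D : K → K → ℝ} {τ : K → V}

/-- If the value is nonnegative for all pseudometrics induced by maps to `K_{2,3}`, then it is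
nonnegative for all potentials. Otherwise take a potential of mass `1` of least value, and among
these one with the least sum of coordinates. It lies in the tight span, and peeling off a
pseudometric induced by a map to `K_{2,3}` decreases the mass but does not increase the value. -/
theorem IsPotential.value_nonneg [Finite V] (hK : Fintype.card K = 5) (hw : ∀ e, 0 ≤ w e)
    (hcut : ∀ φ : V → Fin 5, ∑ t, ∑ t', D t t' * kdist (φ (τ t)) (φ (τ t')) ≤
      ∑ e, w e * kdist (φ (src e)) (φ (tgt e)))
    {F₀ : V → K → ℝ} (hF₀ : IsPotential τ F₀) : 0 ≤ potentialValue src tgt w D τ F₀ := by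
  have := Fintype.ofFinite V
  have : Nonempty K := Fintype.card_pos_iff.1 (by omega)
  have hval_cont : Continuous (potentialValue src tgt w D τ) := by
    unfold potentialValue
    fun_prop
  -- A potential of mass zero has nonnegative value.
  have hzero : ∀ F : V → K → ℝ, IsPotential τ F → potentialMass τ F = 0 →
      0 ≤ potentialValue src tgt w D τ F := by
    intro F hF h
    have h1 : ∀ t t', F (τ t) t' = 0 := fun t t' =>
      le_antisymm ((hF.le_mass t t').trans h.le) (hF.nonneg _ _)
    simp only [potentialValue, h1, mul_zero, Finset.sum_const_zero, sub_zero]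
    exact Finset.sum_nonneg fun e _ => mul_nonneg (hw e) (norm_nonneg _)
  by_contra! hneg
  have hmass : 0 < potentialMass τ F₀ :=
    lt_of_le_of_ne hF₀.mass_nonneg fun h => hneg.not_ge (hzero F₀ hF₀ h.symm)
  obtain ⟨G₀, hG₀, hG₀val⟩ := hF₀.exists_normalized (src := src) (tgt := tgt) (D := D) hw hmass
  obtain ⟨F₁, hF₁, hF₁min⟩ := (isCompact_potentialSet τ).exists_isMinOn ⟨G₀, hG₀⟩
    hval_cont.continuousOn
  set m := potentialValue src tgt w D τ F₁ with hm
  have hm0 : m < 0 := by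
    have h1 : m ≤ potentialValue src tgt w D τ G₀ := hF₁min hG₀
    by_contra! h
    have := mul_nonneg hmass.le (h.trans h1)
    linarith
  have hmin : ∀ F, IsPotential τ F → potentialMass τ F * m ≤ potentialValue src tgt w D τ F := by
    intro F hF
    rcases hF.mass_nonneg.eq_or_lt with h | h
    · rw [← h, zero_mul]
      exact hzero F hF h.symm
    · obtain ⟨G, hG, hGval⟩ := hF.exists_normalized (src := src) (tgt := tgt) (D := D) hw h
      exact (mul_le_mul_of_nonneg_left (hF₁min hG) h.le).trans hGval
  have hC : IsCompact (potentialSet τ ∩ {F | potentialValue src tgt w D τ F ≤ m}) :=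
    (isCompact_potentialSet τ).inter_right (isClosed_le hval_cont continuous_const)
  obtain ⟨F, ⟨⟨hF, hF1, hFle⟩, hFm⟩, hFmin⟩ := hC.exists_isMinOn ⟨F₁, hF₁, le_refl m⟩
    (f := fun F : V → K → ℝ => ∑ v, ∑ t, F v t) (by fun_prop)
  -- All points of `F` lie in the tight span.
  have hT : ∀ v, IsTightFn (fun t t' => F (τ t) t') (F v) := by
    obtain ⟨G, hG, hGτ, hGF, hGlip, hGT⟩ := hF.exists_retract
    have hGC : G ∈ potentialSet τ ∩ {F | potentialValue src tgt w D τ F ≤ m} := by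
      refine ⟨⟨hG, ?_, fun v t => (hGF v t).trans (hFle v t)⟩,
        (potentialValue_mono hw hGτ hGlip).trans hFm⟩
      simpa only [potentialMass, hGτ] using hF1
    have h1 : ∑ v, ∑ t, F v t ≤ ∑ v, ∑ t, G v t := hFmin hGC
    refine hGT fun v t => le_antisymm (hGF v t) ?_
    by_contra! hlt
    refine h1.not_gt (Finset.sum_lt_sum (fun v _ => Finset.sum_le_sum fun t _ => hGF v t)
      ⟨v, Finset.mem_univ v, Finset.sum_lt_sum (fun t _ => hGF v t) ⟨t, Finset.mem_univ t, hlt⟩⟩)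
  have hne : ∃ t t', F (τ t) t' ≠ 0 := by
    by_contra! h
    simp [potentialMass, h] at hF1
  obtain ⟨φ, hφ, s, s', hs⟩ := exists_peel hK hF.isPseudometric hne
  obtain ⟨ε, ⟨hH, hHe⟩, hε⟩ := ((hF.eventually_sub hT hφ).and self_mem_nhdsWithin).exists
  have hε : 0 < ε := hε
  set H : V → K → ℝ := fun v t => F v t - ε * kdist (φ (F (τ t))) (φ (F v)) with hHdef
  set k := ∑ t, ∑ t', kdist (φ (F (τ t))) (φ (F (τ t'))) with hk
  have hk0 : 0 < k := by
    refine (kdist_pos hs).trans_le ?_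
    exact (Finset.single_le_sum (f := fun t' => kdist (φ (F (τ s))) (φ (F (τ t'))))
      (fun _ _ => kdist_nonneg _ _) (Finset.mem_univ s')).trans
      (Finset.single_le_sum (f := fun t => ∑ t', kdist (φ (F (τ t))) (φ (F (τ t'))))
        (fun _ _ => Finset.sum_nonneg fun _ _ => kdist_nonneg _ _) (Finset.mem_univ s))
  have hHmass : potentialMass τ H = 1 - ε * k := by
    rw [← hF1, hk]
    simp only [potentialMass, hHdef, Finset.sum_sub_distrib, Finset.mul_sum]
    congr 1
    exact Finset.sum_congr rfl fun t _ => Finset.sum_congr rfl fun t' _ => by rw [kdist_comm]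
  have hHval : potentialValue src tgt w D τ H ≤ m := by
    have h1 : ∑ e, w e * ‖H (src e) - H (tgt e)‖ ≤ ∑ e, w e * ‖F (src e) - F (tgt e)‖ -
        ε * ∑ e, w e * kdist (φ (F (src e))) (φ (F (tgt e))) := by
      rw [Finset.mul_sum, ← Finset.sum_sub_distrib]
      refine Finset.sum_le_sum fun e _ => ?_
      have := mul_le_mul_of_nonneg_left (hHe (src e) (tgt e)) (hw e)
      linarith
    have h2 : ∑ t, ∑ t', D t t' * H (τ t) t' = ∑ t, ∑ t', D t t' * F (τ t) t' -
        ε * ∑ t, ∑ t', D t t' * kdist (φ (F (τ t))) (φ (F (τ t'))) := by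
      simp only [hHdef, mul_sub, Finset.sum_sub_distrib, Finset.mul_sum]
      congr 1
      refine Finset.sum_congr rfl fun t _ => Finset.sum_congr rfl fun t' _ => ?_
      rw [kdist_comm]
      ring
    have h3 := mul_le_mul_of_nonneg_left (hcut fun v => φ (F v)) hε.le
    refine le_trans ?_ hFm
    simp only [potentialValue]
    linarith
  have h := (hmin H hH).trans hHval
  rw [hHmass] at h
  have := mul_pos hε hk0
  nlinarith

/-- Karzanov's theorem on five terminals, in terms of pseudometrics: a demand that satisfies the
cut condition for all pseudometrics induced by maps to `K_{2,3}` satisfies it for all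
pseudometrics. -/
theorem IsPseudometric.sum_demand_le [Finite V] (hK : Fintype.card K = 5) (hw : ∀ e, 0 ≤ w e)
    (hcut : ∀ φ : V → Fin 5, ∑ t, ∑ t', D t t' * kdist (φ (τ t)) (φ (τ t')) ≤
      ∑ e, w e * kdist (φ (src e)) (φ (tgt e)))
    {δ : V → V → ℝ} (hδ : IsPseudometric δ) :
    ∑ t, ∑ t', D t t' * δ (τ t) (τ t') ≤ ∑ e, w e * δ (src e) (tgt e) := by
  have hF : IsPotential τ fun v t => δ v (τ t) :=
    ⟨fun t => hδ.refl _, fun t t' => hδ.symm _ _, fun v t t' => by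
      have := hδ.triangle (τ t) v (τ t')
      rwa [hδ.symm (τ t) v] at this⟩
  have h := hF.value_nonneg hK hw hcut
  simp only [potentialValue, sub_nonneg] at h
  refine h.trans (Finset.sum_le_sum fun e _ => mul_le_mul_of_nonneg_left ?_ (hw e))
  rw [pi_norm_le_iff_of_nonneg (hδ.nonneg _ _)]
  intro t
  rw [Pi.sub_apply, Real.norm_eq_abs, abs_le]
  have h1 := hδ.triangle (src e) (tgt e) (τ t)
  have h2 := hδ.triangle (tgt e) (src e) (τ t)
  rw [hδ.symm (tgt e) (src e)] at h2
  constructor <;> linarith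

end Extremal

/-! ### Linear programming duality -/

section Farkas

variable {m n : Type*} [Fintype m] [Fintype n]

/-- **Farkas' lemma** for matrices with nonnegative entries and no zero column. For these the cone
spanned by the columns is easily seen to be closed, because the coefficients of its points are
bounded locally. -/
theorem farkas_of_nonneg (A : m → n → ℝ) (hA : ∀ i j, 0 ≤ A i j) (hcol : ∀ j, ∃ i, 0 < A i j)
    (b : m → ℝ) :
    (∃ x : n → ℝ, (∀ j, 0 ≤ x j) ∧ ∀ i, ∑ j, A i j * x j = b i) ∨
    ∃ y : m → ℝ, (∀ j, 0 ≤ ∑ i, y i * A i j) ∧ ∑ i, y i * b i < 0 := by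
  classical
  set T : (n → ℝ) → m → ℝ := fun x i => ∑ j, A i j * x j with hT
  have hTc : Continuous T := by fun_prop
  set S : Set (m → ℝ) := T '' {x | ∀ j, 0 ≤ x j} with hS
  by_cases hb : b ∈ S
  · obtain ⟨x, hx, rfl⟩ := hb
    exact Or.inl ⟨x, hx, fun i => rfl⟩
  right
  have hconv : Convex ℝ S := by
    rintro _ ⟨x, hx, rfl⟩ _ ⟨x', hx', rfl⟩ s s' hs hs' -
    refine ⟨fun j => s * x j + s' * x' j, fun j =>
      add_nonneg (mul_nonneg hs (hx j)) (mul_nonneg hs' (hx' j)), ?_⟩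
    funext i
    simp only [hT, Pi.add_apply, Pi.smul_apply, smul_eq_mul, Finset.mul_sum,
      ← Finset.sum_add_distrib]
    exact Finset.sum_congr rfl fun j _ => by ring
  have hclosed : IsClosed S := by
    refine closure_subset_iff_isClosed.1 fun c hc => ?_
    choose r hr using hcol
    set U : Set (m → ℝ) := {z | ∀ i, z i < c i + 1} with hU
    have hUo : IsOpen U := by
      simp only [hU, Set.ofPred_forall]
      exact isOpen_iInter_of_finite fun i => isOpen_lt (by fun_prop) continuous_const
    set B : Set (n → ℝ) := Set.Icc 0 fun j => (c (r j) + 1) / A (r j) j with hB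
    have hBc : IsCompact (T '' B) := isCompact_Icc.image hTc
    have hsub : U ∩ S ⊆ T '' B := by
      rintro _ ⟨hz, x, hx, rfl⟩
      refine ⟨x, ⟨hx, fun j => ?_⟩, rfl⟩
      rw [le_div_iff₀ (hr j), mul_comm]
      refine le_trans ?_ (hz (r j)).le
      exact Finset.single_le_sum (f := fun j' => A (r j) j' * x j')
        (fun j' _ => mul_nonneg (hA _ _) (hx j')) (Finset.mem_univ j)
    have hcU : c ∈ U := fun i => by linarith
    have h1 : c ∈ T '' B := hBc.isClosed.closure_subset_iff.2 hsub
      (hUo.inter_closure ⟨hcU, hc⟩)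
    obtain ⟨x, hx, rfl⟩ := h1
    exact ⟨x, fun j => hx.1 j, rfl⟩
  obtain ⟨f, u, hfb, hfS⟩ := geometric_hahn_banach_point_closed hconv hclosed hb
  have hu : u < 0 := by
    have := hfS 0 ⟨0, fun j => le_rfl, by funext i; simp [hT]⟩
    simpa using this
  have hf : ∀ z : m → ℝ, f z = ∑ i, f (Pi.single i 1) * z i := by
    intro z
    conv_lhs => rw [pi_eq_sum_univ' z]
    rw [map_sum]
    refine Finset.sum_congr rfl fun i _ => ?_
    rw [map_smul, smul_eq_mul, mul_comm]
  refine ⟨fun i => f (Pi.single i 1), fun j => ?_, by rw [← hf]; exact hfb.trans hu⟩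
  rw [← hf]
  by_contra! hneg
  -- A large multiple of the column `j` violates the separation.
  have hmem : T (Pi.single j (u / f (fun i => A i j))) ∈ S :=
    ⟨_, fun j' => by
      rw [Pi.single_apply]
      split_ifs
      · exact (div_pos_of_neg_of_neg hu hneg).le
      · exact le_rfl, rfl⟩
  have h1 := hfS _ hmem
  have h2 : T (Pi.single j (u / f (fun i => A i j))) = (u / f (fun i => A i j)) •
      fun i => A i j := by
    funext i
    simp [hT, Pi.single_apply, mul_comm]
  rw [h2, map_smul, smul_eq_mul, div_mul_cancel₀ _ hneg.ne] at h1
  exact lt_irrefl _ h1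

end Farkas

/-! ### Walks and paths -/

namespace CapGraph

variable {V E K : Type*} {G : CapGraph V E}

lemma Walk.start_mem_support {u v : V} (p : G.Walk u v) : u ∈ p.support := by
  cases p <;> simp [Walk.support]

lemma Walk.mem_support_of_mem_edges {u v : V} (p : G.Walk u v) {e : E} (he : e ∈ p.edges) {x : V}
    (hx : x ∈ G.ends e) : x ∈ p.support := by
  induction p with
  | nil u => simp [Walk.edges] at he
  | cons e' h p ih =>
    simp only [Walk.edges, List.mem_cons] at he
    rcases he with rfl | he
    · rw [h, Sym2.mem_iff] at hx
      rcases hx with rfl | rfl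
      · simp [Walk.support]
      · simp [Walk.support, p.start_mem_support]
    · simp [Walk.support, ih he]

lemma Walk.edges_nodup {u v : V} (p : G.Walk u v) (hp : p.support.Nodup) : p.edges.Nodup := by
  induction p with
  | nil u => simp [Walk.edges]
  | cons e h p ih =>
    simp only [Walk.support, List.nodup_cons] at hp
    simp only [Walk.edges, List.nodup_cons]
    exact ⟨fun he => hp.1 (p.mem_support_of_mem_edges he (by rw [h]; simp)), ih hp.2⟩

lemma Walk.exists_suffix {u v : V} (p : G.Walk u v) (hp : p.support.Nodup) {x : V}
    (hx : x ∈ p.support) : ∃ q : G.Path x v, q.1.edges.Sublist p.edges := by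
  induction p with
  | nil u =>
    simp only [Walk.support, List.mem_singleton] at hx
    subst hx
    exact ⟨⟨.nil x, hp⟩, List.Sublist.refl _⟩
  | cons e h p ih =>
    simp only [Walk.support, List.mem_cons] at hx
    rcases hx with rfl | hx
    · exact ⟨⟨.cons e h p, hp⟩, List.Sublist.refl _⟩
    · obtain ⟨q, hq⟩ := ih (List.nodup_cons.1 hp).2 hx
      exact ⟨q, hq.trans (List.sublist_cons_self _ _)⟩

/-- Every walk contains a path. -/
lemma Walk.exists_path {u v : V} (p : G.Walk u v) :
    ∃ q : G.Path u v, q.1.edges.Sublist p.edges := by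
  induction p with
  | nil u => exact ⟨⟨.nil u, by simp [Walk.support]⟩, List.Sublist.refl _⟩
  | @cons u _ _ e h p ih =>
    obtain ⟨q, hq⟩ := ih
    by_cases hu : u ∈ q.1.support
    · obtain ⟨q', hq'⟩ := q.1.exists_suffix q.2 hu
      exact ⟨q', (hq'.trans hq).trans (List.sublist_cons_self _ _)⟩
    · exact ⟨⟨.cons e h q.1, List.nodup_cons.2 ⟨hu, q.2⟩⟩, hq.cons_cons e⟩

lemma Walk.edges_injective (u v : V) :
    Function.Injective (Walk.edges : G.Walk u v → List E) := by
  intro p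
  induction p with
  | nil u =>
    intro q h
    cases q with
    | nil => rfl
    | cons e h' q => simp [Walk.edges] at h
  | cons e h p ih =>
    intro q hq
    cases q with
    | nil => simp [Walk.edges] at hq
    | cons e' h' q =>
      simp only [Walk.edges, List.cons.injEq] at hq
      obtain ⟨rfl, hq⟩ := hq
      obtain rfl := Sym2.congr_right.1 (h.symm.trans h')
      rw [ih hq]

instance Path.finite [Finite E] (u v : V) : Finite (G.Path u v) := by
  classical
  have := Fintype.ofFinite E
  refine Finite.of_injective
    (fun p : G.Path u v => (⟨p.1.edges, p.1.edges_nodup p.2⟩ : {l : List E // l.Nodup})) ?_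
  intro p q h
  exact Subtype.ext (Walk.edges_injective u v (Subtype.ext_iff.1 h))

/-- An arbitrary ordering of the two ends of an edge. -/
lemma exists_ends (G : CapGraph V E) (e : E) : ∃ x : V × V, G.ends e = s(x.1, x.2) :=
  Sym2.ind (f := fun z => ∃ x : V × V, z = s(x.1, x.2)) (fun u v => ⟨(u, v), rfl⟩) (G.ends e)

/-- The first end of an edge, for an arbitrary choice of its orientation. -/
def src (G : CapGraph V E) (e : E) : V := (G.exists_ends e).choose.1

/-- The second end of an edge, for an arbitrary choice of its orientation. -/
def tgt (G : CapGraph V E) (e : E) : V := (G.exists_ends e).choose.2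

lemma ends_eq (G : CapGraph V E) (e : E) : G.ends e = s(G.src e, G.tgt e) :=
  (G.exists_ends e).choose_spec

/-- The length of an edge in a pseudometric does not depend on its orientation. -/
lemma dist_src_tgt {δ : V → V → ℝ} (hδ : IsPseudometric δ) {e : E} {u v : V}
    (h : G.ends e = s(u, v)) : δ (G.src e) (G.tgt e) = δ u v := by
  rw [G.ends_eq, Sym2.eq_iff] at h
  rcases h with ⟨h1, h2⟩ | ⟨h1, h2⟩
  · rw [h1, h2]
  · rw [h1, h2, hδ.symm]

lemma Walk.dist_le {δ : V → V → ℝ} (hδ : IsPseudometric δ) {u v : V} (p : G.Walk u v) :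
    δ u v ≤ (p.edges.map fun e => δ (G.src e) (G.tgt e)).sum := by
  induction p with
  | nil u => simp [Walk.edges, hδ.refl]
  | @cons u w v e h p ih =>
    simp only [Walk.edges, List.map_cons, List.sum_cons]
    rw [dist_src_tgt hδ h]
    linarith [hδ.triangle u w v]

/-- Shortest path distances, capped at `M`: edges are no longer than their prescribed length, and
two vertices have distance at least `c ≤ M` if all paths between them have length at least `c`. -/
lemma exists_pseudometric (G : CapGraph V E) (ℓ : E → ℝ) (hℓ : ∀ e, 0 ≤ ℓ e) {M : ℝ}
    (hM : 0 ≤ M) : ∃ δ : V → V → ℝ, IsPseudometric δ ∧ (∀ e, δ (G.src e) (G.tgt e) ≤ ℓ e) ∧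
      ∀ u v c, c ≤ M → (∀ p : G.Path u v, c ≤ (p.1.edges.map ℓ).sum) → c ≤ δ u v := by
  -- The distance is the supremum over all capped potentials that are `1`-Lipschitz on edges.
  let S : Set (V → ℝ) := {h | (∀ v, 0 ≤ h v ∧ h v ≤ M) ∧
    ∀ e u v, G.ends e = s(u, v) → h u ≤ ℓ e + h v}
  have hbd : ∀ u v, BddAbove (Set.range fun h : S => |h.1 u - h.1 v|) := by
    refine fun u v => ⟨M, ?_⟩
    rintro _ ⟨h, rfl⟩
    have h1 := h.2.1 u
    have h2 := h.2.1 v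
    rw [abs_le]
    constructor <;> linarith
  have : Nonempty S := ⟨0, fun v => ⟨le_rfl, hM⟩, fun e u v _ => by simpa using hℓ e⟩
  refine ⟨fun u v => ⨆ h : S, |h.1 u - h.1 v|, ⟨fun u => by simp, fun u v => ?_,
    fun u v w => ?_⟩, fun e => ?_, fun u v c hc hp => ?_⟩
  · simp only [abs_sub_comm]
  · refine ciSup_le fun h => (abs_sub_le _ (h.1 v) _).trans ?_
    exact add_le_add (le_ciSup (hbd u v) h) (le_ciSup (hbd v w) h)
  · refine ciSup_le fun h => ?_
    have h1 := h.2.2 e _ _ (G.ends_eq e)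
    have h2 := h.2.2 e _ _ ((G.ends_eq e).trans Sym2.eq_swap)
    rw [abs_le]
    constructor <;> linarith
  · have hlen : ∀ {x : V} (p : G.Walk x v), 0 ≤ (p.edges.map ℓ).sum := fun p =>
      List.sum_nonneg fun y hy => by
        obtain ⟨e, -, rfl⟩ := List.mem_map.1 hy
        exact hℓ e
    let h : V → ℝ := fun x => ⨅ o : Option (G.Walk x v), o.elim M fun p => (p.edges.map ℓ).sum
    have hbelow : ∀ x, BddBelow (Set.range fun o : Option (G.Walk x v) =>
        o.elim M fun p => (p.edges.map ℓ).sum) := by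
      refine fun x => ⟨0, ?_⟩
      rintro _ ⟨_ | p, rfl⟩
      · exact hM
      · exact hlen p
    have hhM : ∀ x, h x ≤ M := fun x => ciInf_le (hbelow x) none
    have hhp : ∀ x (p : G.Walk x v), h x ≤ (p.edges.map ℓ).sum := fun x p =>
      ciInf_le (hbelow x) (some p)
    have hh0 : ∀ x, 0 ≤ h x := fun x => le_ciInf fun o => by
      rcases o with _ | p
      · exact hM
      · exact hlen p
    have hS : h ∈ S := by
      refine ⟨fun x => ⟨hh0 x, hhM x⟩, fun e x y he => ?_⟩
      rw [← sub_le_iff_le_add']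
      refine le_ciInf fun o => ?_
      rcases o with _ | p
      · simp only [Option.elim]
        linarith [hhM x, hℓ e]
      · have := hhp x (.cons e he p)
        simp only [Walk.edges, List.map_cons, List.sum_cons] at this
        simp only [Option.elim]
        linarith
    have hv : h v = 0 := le_antisymm (by simpa [Walk.edges] using hhp v (.nil v)) (hh0 v)
    have hu : c ≤ h u := le_ciInf fun o => by
      rcases o with _ | p
      · exact hc
      · obtain ⟨q, hq⟩ := p.exists_path
        refine (hp q).trans ((hq.map ℓ).sum_le_sum ?_)
        intro y hy
        obtain ⟨e, -, rfl⟩ := List.mem_map.1 hy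
        exact hℓ e
    refine hu.trans (le_trans ?_ (le_ciSup (hbd u v) ⟨h, hS⟩))
    simp only [hv, sub_zero]
    exact le_abs_self _

/-! ### Flows and their duals -/

/-- Weak duality: the demand-weighted distances of the terminals are at most the capacities of the
edges, multiplied by the congestion and by the lengths of the edges. The factor `2` is due to the
sum over ordered pairs of terminals. -/
lemma Flow.sum_demand_le [Fintype E] [Fintype K] {τ : K → V} (f : G.Flow τ) {D : Sym2 K → ℝ≥0}
    (hf : f.Routes D) {κ : ℝ≥0} (hload : ∀ e, f.load e ≤ κ * G.cap e) {δ : V → V → ℝ}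
    (hδ : IsPseudometric δ) :
    ∑ t, ∑ t', (D s(t, t') : ℝ) * δ (τ t) (τ t') ≤
      ∑ e, 2 * (κ * G.cap e : ℝ) * δ (G.src e) (G.tgt e) := by
  classical
  set len : E → ℝ := fun e => δ (G.src e) (G.tgt e) with hlen
  set X : K → K → ℝ := fun t t' => (f t t').sum fun _ x => (x : ℝ) with hX
  have hbetween : ∀ t t', (f.between t t' : ℝ) = X t t' + X t' t := by
    intro t t'
    simp only [Flow.between, hX, Finsupp.sum, NNReal.coe_add, NNReal.coe_sum]
  have h1 : ∑ t, ∑ t', (D s(t, t') : ℝ) * δ (τ t) (τ t') =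
      2 * ∑ t, ∑ t', X t t' * δ (τ t) (τ t') := by
    have h2 : ∀ t t', (D s(t, t') : ℝ) * δ (τ t) (τ t') =
        X t t' * δ (τ t) (τ t') + X t' t * δ (τ t') (τ t) := by
      intro t t'
      by_cases h : t = t'
      · subst h
        simp [hδ.refl]
      · rw [← hf t t' h, hbetween, hδ.symm (τ t') (τ t), add_mul]
    simp only [h2, Finset.sum_add_distrib]
    rw [Finset.sum_comm (f := fun t t' => X t' t * δ (τ t') (τ t)), two_mul]
  have hpath : ∀ t t' (p : G.Path (τ t) (τ t')), δ (τ t) (τ t') ≤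
      ∑ e, if e ∈ p.1.edges then len e else 0 := by
    intro t t' p
    refine (p.1.dist_le hδ).trans (le_of_eq ?_)
    rw [← List.sum_toFinset _ (p.1.edges_nodup p.2), ← Finset.sum_filter]
    refine Finset.sum_congr ?_ fun _ _ => rfl
    ext e
    simp
  have h2 : ∀ t t', X t t' * δ (τ t) (τ t') ≤
      ∑ e, (((f t t').sum fun p x => if e ∈ p.1.edges then x else 0 : ℝ≥0) : ℝ) * len e := by
    intro t t'
    simp only [hX, Finsupp.sum, NNReal.coe_sum, Finset.sum_mul]
    rw [Finset.sum_comm]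
    refine Finset.sum_le_sum fun p _ => ?_
    refine (mul_le_mul_of_nonneg_left (hpath t t' p) (NNReal.coe_nonneg _)).trans (le_of_eq ?_)
    rw [Finset.mul_sum]
    refine Finset.sum_congr rfl fun e _ => ?_
    split_ifs <;> simp
  have h3 : ∑ t, ∑ t', X t t' * δ (τ t) (τ t') ≤ ∑ e, (f.load e : ℝ) * len e := by
    refine (Finset.sum_le_sum fun t _ => Finset.sum_le_sum fun t' _ => h2 t t').trans
      (le_of_eq ?_)
    simp only [Flow.load, NNReal.coe_sum, Finset.sum_mul]
    symm
    rw [Finset.sum_comm]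
    exact Finset.sum_congr rfl fun t _ => Finset.sum_comm
  rw [h1]
  have h4 : ∑ e, (f.load e : ℝ) * len e ≤ ∑ e, (κ * G.cap e : ℝ) * len e :=
    Finset.sum_le_sum fun e _ => mul_le_mul_of_nonneg_right (by exact_mod_cast hload e)
      (hδ.nonneg _ _)
  calc _ ≤ 2 * ∑ e, (κ * G.cap e : ℝ) * len e := by linarith
    _ = _ := by rw [Finset.mul_sum]; simp only [mul_assoc, hlen]

/-- Strong duality: if all pseudometrics satisfy the cut condition, then the demand can be
routed. -/
lemma exists_flow [Fintype E] [Fintype K] (G : CapGraph V E) (τ : K → V) (D : Sym2 K → ℝ≥0)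
    (κ : ℝ≥0)
    (h : ∀ δ : V → V → ℝ, IsPseudometric δ → ∑ t, ∑ t', (D s(t, t') : ℝ) * δ (τ t) (τ t') ≤
      ∑ e, 2 * (κ * G.cap e : ℝ) * δ (G.src e) (G.tgt e)) :
    ∃ f : G.Flow τ, f.Routes D ∧ ∀ e, f.load e ≤ κ * G.cap e := by
  classical
  have : ∀ u v, Fintype (G.Path u v) := fun u v => Fintype.ofFinite _
  -- The rows are the ordered pairs of terminals and the edges; the columns are the paths and a
  -- slack variable for every edge. Half of each demand is routed in either direction.
  let A : (K × K) ⊕ E → (Σ q : K × K, G.Path (τ q.1) (τ q.2)) ⊕ E → ℝ := fun i j => match i, j with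
    | .inl q, .inl j => if j.1 = q then 1 else 0
    | .inl _, .inr _ => 0
    | .inr e, .inl j => if e ∈ j.2.1.edges then 1 else 0
    | .inr e, .inr e' => if e = e' then 1 else 0
  let b : (K × K) ⊕ E → ℝ := Sum.elim (fun q => (D s(q.1, q.2) : ℝ) / 2) fun e => κ * G.cap e
  have hA : ∀ i j, 0 ≤ A i j := by
    rintro (q | e) (j | e') <;> dsimp only [A] <;> first | exact le_rfl | (split_ifs <;> norm_num)
  have hcol : ∀ j, ∃ i, 0 < A i j := by
    rintro (j | e)
    · exact ⟨.inl j.1, by simp [A]⟩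
    · exact ⟨.inr e, by simp [A]⟩
  rcases farkas_of_nonneg A hA hcol b with ⟨x, hx0, hx⟩ | ⟨y, hy, hyb⟩
  · let f : G.Flow τ := fun t t' => Finsupp.equivFunOnFinite.symm fun p =>
      ⟨x (.inl ⟨(t, t'), p⟩), hx0 _⟩
    have hfx : ∀ t t' p, (f t t' p : ℝ) = x (.inl ⟨(t, t'), p⟩) := fun _ _ _ => rfl
    have hsum : ∀ t t', (((f t t').sum fun _ x => x : ℝ≥0) : ℝ) = (D s(t, t') : ℝ) / 2 := by
      intro t t'
      have h1 := hx (.inl (t, t'))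
      simp only [Fintype.sum_sum_type, A, b, Sum.elim_inl, zero_mul, Finset.sum_const_zero,
        add_zero, Fintype.sum_sigma] at h1
      rw [Finset.sum_eq_single (t, t') (fun q _ hq => by simp [hq]) (by simp)] at h1
      rw [← h1, Finsupp.sum_fintype _ _ (by simp), NNReal.coe_sum]
      exact Finset.sum_congr rfl fun p _ => by simp [hfx]
    refine ⟨f, fun t t' _ => ?_, fun e => ?_⟩
    · apply NNReal.coe_injective
      simp only [Flow.between, NNReal.coe_add, hsum]
      rw [Sym2.eq_swap (a := t') (b := t)]
      ring
    · have h1 := hx (.inr e)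
      simp only [Fintype.sum_sum_type, A, b, Sum.elim_inr, Fintype.sum_sigma, ite_mul, one_mul,
        zero_mul, Finset.sum_ite_eq, Finset.mem_univ, if_true, Fintype.sum_prod_type] at h1
      have h2 : (f.load e : ℝ) = ∑ t, ∑ t', ∑ p : G.Path (τ t) (τ t'),
          if e ∈ p.1.edges then x (.inl ⟨(t, t'), p⟩) else 0 := by
        simp only [Flow.load, NNReal.coe_sum]
        refine Finset.sum_congr rfl fun t _ => Finset.sum_congr rfl fun t' _ => ?_
        rw [Finsupp.sum_fintype _ _ (by simp), NNReal.coe_sum]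
        refine Finset.sum_congr rfl fun p _ => ?_
        split_ifs <;> simp [hfx]
      rw [← NNReal.coe_le_coe, NNReal.coe_mul, ← h1, h2]
      exact le_add_of_nonneg_right (hx0 _)
  · exfalso
    have hℓ : ∀ e, 0 ≤ y (.inr e) := fun e => by
      have := hy (.inr e)
      simpa [Fintype.sum_sum_type, A] using this
    have hp : ∀ t t' (p : G.Path (τ t) (τ t')),
        -y (.inl (t, t')) ≤ (p.1.edges.map fun e => y (.inr e)).sum := by
      intro t t' p
      have h1 := hy (.inl ⟨(t, t'), p⟩)
      simp only [Fintype.sum_sum_type, A, mul_ite, mul_one, mul_zero, Finset.sum_ite_eq,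
        Finset.mem_univ, if_true] at h1
      rw [← List.sum_toFinset _ (p.1.edges_nodup p.2)]
      have h2 : ∑ e ∈ p.1.edges.toFinset, y (.inr e) =
          ∑ e, if e ∈ p.1.edges then y (.inr e) else 0 := by
        rw [← Finset.sum_filter]
        refine Finset.sum_congr ?_ fun _ _ => rfl
        ext e
        simp
      linarith
    obtain ⟨δ, hδ, hδe, hδp⟩ := G.exists_pseudometric (fun e => y (.inr e)) hℓ
      (M := ∑ q : K × K, |y (.inl q)|) (Finset.sum_nonneg fun _ _ => abs_nonneg _)
    have hδt : ∀ t t', -y (.inl (t, t')) ≤ δ (τ t) (τ t') := fun t t' =>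
      hδp _ _ _ ((neg_le_abs _).trans (Finset.single_le_sum
        (f := fun q : K × K => |y (.inl q)|) (fun _ _ => abs_nonneg _)
        (Finset.mem_univ (t, t')))) (hp t t')
    have h1 : ∑ t, ∑ t', (D s(t, t') : ℝ) * -y (.inl (t, t')) ≤
        ∑ t, ∑ t', (D s(t, t') : ℝ) * δ (τ t) (τ t') :=
      Finset.sum_le_sum fun t _ => Finset.sum_le_sum fun t' _ =>
        mul_le_mul_of_nonneg_left (hδt t t') (NNReal.coe_nonneg _)
    have h2 : ∑ e, 2 * (κ * G.cap e : ℝ) * δ (G.src e) (G.tgt e) ≤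
        ∑ e, 2 * (κ * G.cap e : ℝ) * y (.inr e) :=
      Finset.sum_le_sum fun e _ => mul_le_mul_of_nonneg_left (hδe e) (by positivity)
    have h3 : 2 * ∑ i, y i * b i = ∑ t, ∑ t', (D s(t, t') : ℝ) * y (.inl (t, t')) +
        ∑ e, 2 * (κ * G.cap e : ℝ) * y (.inr e) := by
      simp only [Fintype.sum_sum_type, b, Sum.elim_inl, Sum.elim_inr, Fintype.sum_prod_type,
        mul_add, Finset.mul_sum]
      congr 1
      · exact Finset.sum_congr rfl fun t _ => Finset.sum_congr rfl fun t' _ => by ring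
      · exact Finset.sum_congr rfl fun e _ => by ring
    have h4 := h δ hδ
    simp only [mul_neg, Finset.sum_neg_distrib] at h1
    linarith

/-! ### Contractions -/

/-- The image of a walk under a contraction contains a path. -/
lemma Walk.exists_contract_path (F : Setoid V) {u v : V} (p : G.Walk u v) :
    ∃ q : (G.contract F).Path (Quotient.mk F u) (Quotient.mk F v),
      ∀ e ∈ q.1.edges, e.1 ∈ p.edges := by
  have key : ∃ q : (G.contract F).Walk (Quotient.mk F u) (Quotient.mk F v),
      ∀ e ∈ q.edges, e.1 ∈ p.edges := by
    induction p with
    | nil u => exact ⟨.nil _, by simp [Walk.edges]⟩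
    | @cons u w v e h p ih =>
      obtain ⟨q, hq⟩ := ih
      have hmap : (G.ends e).map (Quotient.mk F) = s(Quotient.mk F u, Quotient.mk F w) := by
        rw [h, Sym2.map_mk]
      by_cases huw : Quotient.mk F u = Quotient.mk F w
      · rw [huw]
        exact ⟨q, fun e' he' => List.mem_cons_of_mem _ (hq e' he')⟩
      · refine ⟨.cons ⟨e, by rw [hmap]; simpa using huw⟩ hmap q, fun e' he' => ?_⟩
        simp only [Walk.edges, List.mem_cons] at he' ⊢
        rcases he' with rfl | he'
        · exact Or.inl rfl
        · exact Or.inr (hq e' he')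
  obtain ⟨q, hq⟩ := key
  obtain ⟨q', hq'⟩ := q.exists_path
  exact ⟨q', fun e he => hq e (hq'.subset he)⟩

/-- Contracting does not increase the congestion of a demand. -/
lemma congestion_contract_le [Fintype K] (G : CapGraph V E) (F : Setoid V) (τ : K → V)
    (D : Sym2 K → ℝ≥0) :
    (G.contract F).congestion (fun t => Quotient.mk F (τ t)) D ≤ G.congestion τ D := by
  classical
  refine le_iInf₂ fun f hf => ?_
  choose proj hproj using fun (t t' : K) (p : G.Path (τ t) (τ t')) =>
    p.1.exists_contract_path F
  let g : (G.contract F).Flow (fun t => Quotient.mk F (τ t)) := fun t t' =>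
    (f t t').mapDomain (proj t t')
  have hsum : ∀ t t', ((g t t').sum fun _ x => x) = (f t t').sum fun _ x => x := fun t t' =>
    Finsupp.sum_mapDomain_index (fun _ => rfl) (fun _ _ _ => rfl)
  refine iInf₂_le_of_le g (fun t t' h => ?_) (iSup_le fun e => ?_)
  · rw [← hf t t' h, Flow.between, Flow.between, hsum, hsum]
  · refine le_iSup_of_le e.1 (ENNReal.div_le_div_right (ENNReal.coe_le_coe.2 ?_) _)
    refine Finset.sum_le_sum fun t _ => Finset.sum_le_sum fun t' _ => ?_
    rw [Finsupp.sum_mapDomain_index (fun _ => by simp) (fun _ _ _ => by split_ifs <;> simp)]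
    refine Finset.sum_le_sum fun p _ => ?_
    dsimp only
    split_ifs with h1 h2
    · exact le_rfl
    · exact absurd (hproj t t' p e h1) h2
    · exact zero_le
    · exact le_rfl

lemma isPseudometric_kdist (ψ : V → Fin 5) : IsPseudometric fun u v => kdist (ψ u) (ψ v) :=
  ⟨fun _ => kdist_self _, fun _ _ => kdist_comm _ _, fun _ _ _ => kdist_triangle _ _ _⟩

/-- The total capacity-weighted length of the edges in the pseudometric induced by a map to
`K_{2,3}`. -/
def cost [Fintype E] (G : CapGraph V E) (ψ : V → Fin 5) : ℝ :=
  ∑ e, (G.cap e : ℝ) * kdist (ψ (G.src e)) (ψ (G.tgt e))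

/-- A map that is constant on the classes of a contraction has the same cost in the contracted
graph, because the discarded edges have length `0`. -/
lemma cost_contract [Fintype E] (F : Setoid V)
    [Fintype {e : E // ¬ ((G.ends e).map (Quotient.mk F)).IsDiag}] (ψ : Quotient F → Fin 5) :
    (G.contract F).cost ψ = G.cost fun v => ψ (Quotient.mk F v) := by
  classical
  have h1 : ∀ e : {e : E // ¬ ((G.ends e).map (Quotient.mk F)).IsDiag},
      ((G.contract F).cap e : ℝ) * kdist (ψ ((G.contract F).src e)) (ψ ((G.contract F).tgt e)) =
      (G.cap e.1 : ℝ) * kdist (ψ (Quotient.mk F (G.src e))) (ψ (Quotient.mk F (G.tgt e))) := by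
    intro e
    have he : (G.contract F).ends e = s(Quotient.mk F (G.src e), Quotient.mk F (G.tgt e)) := by
      change (G.ends e.1).map (Quotient.mk F) = _
      rw [G.ends_eq, Sym2.map_mk]
    rw [dist_src_tgt (isPseudometric_kdist ψ) he]
    rfl
  unfold cost
  rw [Finset.sum_congr rfl fun e _ => h1 e]
  rw [← Finset.sum_filter_of_ne (p := fun e => ¬ ((G.ends e).map (Quotient.mk F)).IsDiag)]
  · exact (Finset.sum_subtype _ (by simp) fun e => (G.cap e : ℝ) *
      kdist (ψ (Quotient.mk F (G.src e))) (ψ (Quotient.mk F (G.tgt e)))).symm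
  · intro e _ hne hdiag
    rw [G.ends_eq, Sym2.map_mk, Sym2.mk_isDiag_iff] at hdiag
    simp only [hdiag, kdist_self, mul_zero, ne_eq, not_true_eq_false] at hne

lemma sum_cap_mul_kdist [Fintype E] (G : CapGraph V E) (κ : ℝ≥0) (ψ : V → Fin 5) :
    ∑ e, 2 * (κ * G.cap e : ℝ) * kdist (ψ (G.src e)) (ψ (G.tgt e)) = 2 * κ * G.cost ψ := by
  rw [cost, Finset.mul_sum]
  exact Finset.sum_congr rfl fun e _ => by ring

/-- If every map to `K_{2,3}` can be replaced by one that is constant on the classes of the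
contraction, agrees with it on the terminals and costs no more, then contracting does not decrease
the congestion of a demand between five terminals. -/
lemma congestion_le_of_cost [Finite V] [Fintype E] [Fintype K] (hK : Fintype.card K = 5)
    (G : CapGraph V E) (F : Setoid V) (τ : K → V)
    (hF : ∀ φ : V → Fin 5, ∃ ψ : Quotient F → Fin 5, (∀ t, ψ (Quotient.mk F (τ t)) = φ (τ t)) ∧
      G.cost (fun v => ψ (Quotient.mk F v)) ≤ G.cost φ) (D : Sym2 K → ℝ≥0) :
    G.congestion τ D ≤ (G.contract F).congestion (fun t => Quotient.mk F (τ t)) D := by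
  classical
  refine le_iInf₂ fun g hg => ?_
  by_cases htop : g.congestion = ⊤
  · rw [htop]
    exact le_top
  obtain ⟨κ, hκ⟩ : ∃ κ : ℝ≥0, (κ : ℝ≥0∞) = g.congestion := ⟨_, ENNReal.coe_toNNReal htop⟩
  have hload : ∀ e, g.load e ≤ κ * (G.contract F).cap e := by
    intro e
    have h1 : (g.load e : ℝ≥0∞) / ((G.contract F).cap e : ℝ≥0∞) ≤ κ := by
      rw [hκ]
      exact le_iSup (fun e => (g.load e : ℝ≥0∞) / ((G.contract F).cap e : ℝ≥0∞)) e
    rw [ENNReal.div_le_iff (by simpa using ((G.contract F).cap_pos e).ne') ENNReal.coe_ne_top] at h1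
    exact_mod_cast h1
  have hcut : ∀ φ : V → Fin 5, ∑ t, ∑ t', (D s(t, t') : ℝ) * kdist (φ (τ t)) (φ (τ t')) ≤
      ∑ e, 2 * (κ * G.cap e : ℝ) * kdist (φ (G.src e)) (φ (G.tgt e)) := by
    intro φ
    obtain ⟨ψ, hψ, hcost⟩ := hF φ
    have h1 := g.sum_demand_le hg hload (isPseudometric_kdist ψ)
    rw [sum_cap_mul_kdist, cost_contract] at h1
    simp only [hψ] at h1
    rw [sum_cap_mul_kdist]
    exact h1.trans (mul_le_mul_of_nonneg_left hcost (by positivity))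
  obtain ⟨f, hf, hfload⟩ := G.exists_flow τ D κ fun δ hδ =>
    hδ.sum_demand_le hK (fun e => by positivity) hcut
  rw [← hκ]
  refine iInf₂_le_of_le f hf (iSup_le fun e => ?_)
  rw [ENNReal.div_le_iff (by simpa using (G.cap_pos e).ne') ENNReal.coe_ne_top]
  exact_mod_cast hfload e

/-- Partition the vertices by their images under maps to `K_{2,3}` of least cost, one for each
choice of the images of the terminals. -/
lemma exists_partition [Finite V] [Fintype E] (G : CapGraph V E) (T : Finset V) :
    ∃ F : Setoid V, (∀ t ∈ T, ∀ t' ∈ T, F t t' → t = t') ∧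
      (∀ φ : V → Fin 5, ∃ ψ : Quotient F → Fin 5,
        (∀ t : T, ψ (Quotient.mk F (t : V)) = φ t) ∧
          G.cost (fun v => ψ (Quotient.mk F v)) ≤ G.cost φ) ∧
      Nat.card (Quotient F) ≤ 5 ^ 5 ^ T.card := by
  classical
  have := Fintype.ofFinite V
  have hmin : ∀ σ : T → Fin 5, ∃ φ : V → Fin 5, (∀ t : T, φ t = σ t) ∧
      ∀ φ' : V → Fin 5, (∀ t : T, φ' t = σ t) → G.cost φ ≤ G.cost φ' := by
    intro σ
    obtain ⟨φ, hφ, hmin⟩ := Set.exists_min_image {φ : V → Fin 5 | ∀ t : T, φ t = σ t} G.cost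
      (Set.toFinite _) ⟨fun v => if h : v ∈ T then σ ⟨v, h⟩ else 0, fun t => by simp⟩
    exact ⟨φ, hφ, hmin⟩
  choose Φ hΦ hΦmin using hmin
  let code : V → (T → Fin 5) → Fin 5 := fun v σ => Φ σ v
  refine ⟨Setoid.ker code, fun t ht t' ht' h => ?_, fun φ => ?_, ?_⟩
  · by_contra hne
    let σ : T → Fin 5 := fun s => if (s : V) = t then 0 else 1
    have h1 : code t σ = code t' σ := congrFun h σ
    have h2 : code t σ = σ ⟨t, ht⟩ := hΦ σ ⟨t, ht⟩
    have h3 : code t' σ = σ ⟨t', ht'⟩ := hΦ σ ⟨t', ht'⟩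
    rw [h2, h3] at h1
    simp [σ, Ne.symm hne] at h1
  · refine ⟨Quotient.lift (fun v => code v fun t => φ t) fun u v h => congrFun h _,
      fun t => hΦ (fun t => φ t) t, hΦmin _ φ fun t => rfl⟩
  · have hcard : Nat.card ((T → Fin 5) → Fin 5) = 5 ^ 5 ^ T.card := by simp
    rw [← hcard]
    exact Nat.card_le_card_of_injective _ (Setoid.kerLift_injective code)

end CapGraph

end

theorem theorem1p1 :
    ∃ p : Polynomial ℝ, ∀ ε : ℝ, 0 < ε →
      ∀ (V E : Type*) [Finite V] [Finite E] (G : CapGraph V E) (T : Finset V), T.card = 5 →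
        ∃ F : Setoid V, G.IsContractionSparsifier T F (1 + ε) ∧
          (Nat.card (Quotient F) : ℝ) ≤ (2 : ℝ) ^ (p.eval (1 / ε)) := by
  -- The sparsifier is exact and its size is bounded independently of `ε`.
  refine ⟨Polynomial.C ((3 * 5 ^ 5 : ℕ) : ℝ), fun ε hε V E _ _ G T hT => ?_⟩
  have := Fintype.ofFinite E
  obtain ⟨F, hsep, hF, hcard⟩ := G.exists_partition T
  refine ⟨F, ⟨hsep, by linarith, fun D => ⟨?_, ?_⟩⟩, ?_⟩
  · exact G.congestion_contract_le F (fun t : T => (t : V)) D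
  · refine (G.congestion_le_of_cost (by simpa using hT) F (fun t : T => (t : V)) hF D).trans ?_
    refine le_mul_of_one_le_left zero_le ?_
    rw [ENNReal.one_le_ofReal]
    linarith
  · rw [Polynomial.eval_C, Real.rpow_natCast]
    rw [hT] at hcard
    have h1 : (5 : ℕ) ^ 5 ^ 5 ≤ 2 ^ (3 * 5 ^ 5) := by
      rw [pow_mul]
      exact Nat.pow_le_pow_left (by norm_num) _
    exact_mod_cast hcard.trans h1
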